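/- Let $\mathrm{CCS}_f$ be the language of terms $t ::= \mathbf 0 \mid x \mid \mu.t \mid t+t \mid t\parallel t \mid f(t,t)$, where $x$ ranges over a countably infinite set of variables and $\mu\in\{a,\bar a,\tau\}$ (with $\bar{\bar a}=a$). Terms are considered modulo associativity and commutativity of $+$; the summands of $t$ are the terms $t_i$ whose head operator is not $+$ such that $t=t_1+\dots+t_k$. The size of a term is its number of operator symbols. Closed terms carry the transitions given by the usual rules for CCS without recursion, restriction and relabelling, together with a set of rules for the binary operator $f$; $\sim$ denotes (strong) bisimilarity. An equation is sound if all its closed instances relate bisimilar terms. $\mathcal E\vdash t\approx u$ denotes derivability in equational logic. Assume that (1) the rules for $f$ are in de Simone format; (2) the equation $x\parallel y\approx f(x,y)+f(y,x)$ is sound; (3) the target of each rule for $f$ is a variable or a single operator of $\mathrm{CCS}_f$ applied to variables of the rule; (4) for some fixed $\alpha\in\{a,\bar a\}$, the rules for $f$ include (possibly among others) $$\frac{x\xrightarrow{\alpha}x'}{f(x,y)\xrightarrow{\alpha}x'\parallel y}\qquad\text{and}\qquad\frac{y\xrightarrow{\alpha}y'}{f(x,y)\xrightarrow{\alpha}x\parallel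 y'} .$$ For $n\ge 0$ let $\bar\alpha^{\le i}=\bar\alpha+\bar\alpha^2+\dots+\bar\alpha^i$ (with $\bar\alpha^{\le 0}=\mathbf 0$), let $q_n=\sum_{i=0}^n\alpha.\bar\alpha^{\le i}$, and let $\varepsilon_n$ be the equation $$f(\alpha,q_n)\;\approx\;\alpha.q_n+\sum_{i=0}^n\alpha.(\alpha\parallel\bar\alpha^{\le i}).$$ **Theorem.** Let $\mathcal E$ be a finite axiom system over $\mathrm{CCS}_f$ that is sound modulo $\sim$, and let $n$ be larger than the size of each term in the equations of $\mathcal E$. Let $p,q$ be closed terms with $p\sim f(\alpha,q_n)$, $q\sim f(\alpha,q_n)$ and $\mathcal E\vdash p\approx q$. If $p$ has a summand $s$ that is bisimilar to $f(\alpha,q_n)$ and is not of the form $s_1\parallel s_2$ or $f(s_1,s_2)$ with $s_1\sim\mathbf 0$ or $s_2\sim\mathbf 0$, then $q$ has a summand bisimilar to $f(\alpha,q_n)$. Moreover, the equation $\varepsilon_n$ is sound modulo $\sim$, and $\mathcal E\not\vdash\varepsilon_n$. -/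

import Mathlib

namespace CCSf

/-- The visible actions: the name `a` and its co-name. -/
inductive Vis
  | a
  | abar

/-- Complementation of visible actions. -/
def Vis.bar : Vis → Vis
  | .a => .abar
  | .abar => .a

/-- The three actions `a`, its complement, and the silent action `τ`. -/
inductive Act
  | vis (α : Vis)
  | tau

/-- Terms of CCS extended with one binary operator `op` (the operator `f`); the variables are
indexed by `ℕ`. -/
inductive Tm
  | zero
  | var (x : ℕ)
  | pre (μ : Act) (t : Tm)
  | plus (t u : Tm)
  | par (t u : Tm)
  | op (t u : Tm)

namespace Tm

/-- Application of a substitution to a term. -/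
def subst (σ : ℕ → Tm) : Tm → Tm
  | zero => zero
  | var x => σ x
  | pre μ t => pre μ (subst σ t)
  | plus t u => plus (subst σ t) (subst σ u)
  | par t u => par (subst σ t) (subst σ u)
  | op t u => op (subst σ t) (subst σ u)

/-- The number of operator symbols in a term (`zero` is a constant symbol). -/
def size : Tm → ℕ
  | zero => 1
  | var _ => 0
  | pre _ t => size t + 1
  | plus t u => size t + size u + 1
  | par t u => size t + size u + 1
  | op t u => size t + size u + 1

/-- The number of occurrences of the variable `x` in a term. -/
def occ (x : ℕ) : Tm → ℕ
  | zero => 0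
  | var y => if x = y then 1 else 0
  | pre _ t => occ x t
  | plus t u => occ x t + occ x u
  | par t u => occ x t + occ x u
  | op t u => occ x t + occ x u

/-- A term without variables. -/
def Closed (t : Tm) : Prop := ∀ x, t.occ x = 0

/-- `s.IsSummand t`: writing `t` as a sum of terms whose head operator is not `+`, the term `s` is
one of them. -/
def IsSummand (s : Tm) : Tm → Prop
  | plus t u => IsSummand s t ∨ IsSummand s u
  | t => s = t

/-- Finite sums; the empty sum is `zero`, and a sum of one term is that term. -/
def sum : List Tm → Tm
  | [] => zero
  | [t] => t
  | t :: u :: l => plus t (sum (u :: l))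

/-- `pow μ m` is `μ` prefixed `m` times to `zero`. -/
def pow (μ : Act) : ℕ → Tm
  | 0 => zero
  | m + 1 => pre μ (pow μ m)

/-- `powLe μ i` is the sum `μ + μ² + ⋯ + μⁱ`. -/
def powLe (μ : Act) (i : ℕ) : Tm := sum ((List.range i).map fun j => pow μ (j + 1))

/-- The term is a variable. -/
def IsVar : Tm → Prop
  | var _ => True
  | _ => False

/-- The term is a variable, or one operator applied to variables. -/
def IsFlat : Tm → Prop
  | zero => True
  | var _ => True
  | pre _ t => IsVar t
  | plus t u => IsVar t ∧ IsVar u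
  | par t u => IsVar t ∧ IsVar u
  | op t u => IsVar t ∧ IsVar u

end Tm

open Tm

/-- The variable `x` of a rule, standing for the first argument. -/
def vx : ℕ := 0
/-- The variable `y` of a rule, standing for the second argument. -/
def vy : ℕ := 1
/-- The variable `x'` of a rule, standing for the target of the premise on `x`. -/
def vx' : ℕ := 2
/-- The variable `y'` of a rule, standing for the target of the premise on `y`. -/
def vy' : ℕ := 3

/-- A transition rule for `f`. Its premises are `x -ν→ x'` if `prem₁ = some ν` (none on `x` if
`prem₁ = none`) and `y -ν→ y'` if `prem₂ = some ν` (none on `y` if `prem₂ = none`); its conclusion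
is `f(x, y) -act→ target`. -/
structure Rule where
  prem₁ : Option Act
  prem₂ : Option Act
  act : Act
  target : Tm

/-- The rule is in de Simone format: every variable occurs at most once in the target, and the
target contains only `x'` or `y'` for arguments with a premise, `x` or `y` for those without. -/
def Rule.IsDeSimone (r : Rule) : Prop :=
  ∀ v, r.target.occ v ≤ 1 ∧ (r.target.occ v ≠ 0 →
    (v = vx ∧ r.prem₁ = none) ∨ (v = vy ∧ r.prem₂ = none) ∨
    (v = vx' ∧ r.prem₁ ≠ none) ∨ (v = vy' ∧ r.prem₂ ≠ none))

/-- The substitution instantiating the variables of a rule. -/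
def ruleSubst (p q p' q' : Tm) : ℕ → Tm
  | 0 => p
  | 1 => q
  | 2 => p'
  | 3 => q'
  | _ => zero

/-- The transitions provable from the rules of CCS and the set `R` of rules for `f`. (For rules in
de Simone format, closed terms have transitions to closed terms only.) -/
inductive Step (R : Set Rule) : Tm → Act → Tm → Prop
  | pre (μ : Act) (p : Tm) : Step R (.pre μ p) μ p
  | plusL {p q p' : Tm} {μ : Act} : Step R p μ p' → Step R (.plus p q) μ p'
  | plusR {p q q' : Tm} {μ : Act} : Step R q μ q' → Step R (.plus p q) μ q'
  | parL {p q p' : Tm} {μ : Act} : Step R p μ p' → Step R (.par p q) μ (.par p' q)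
  | parR {p q q' : Tm} {μ : Act} : Step R q μ q' → Step R (.par p q) μ (.par p q')
  | sync {p q p' q' : Tm} {α : Vis} : Step R p (.vis α) p' → Step R q (.vis α.bar) q' →
      Step R (.par p q) .tau (.par p' q')
  | op {r : Rule} {p q p' q' : Tm} : r ∈ R →
      (∀ ν, r.prem₁ = some ν → Step R p ν p') →
      (∀ ν, r.prem₂ = some ν → Step R q ν q') →
      Step R (.op p q) r.act (r.target.subst (ruleSubst p q p' q'))

/-- Bisimilarity: the largest symmetric relation with the transfer property. It is used for closed
terms only. -/
def Bisim (R : Set Rule) (p q : Tm) : Prop :=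
  ∃ S : Tm → Tm → Prop,
    (∀ u v, S u v → S v u) ∧
    (∀ u v μ u', S u v → Step R u μ u' → ∃ v', Step R v μ v' ∧ S u' v') ∧
    S p q

/-- An equation is sound if all its closed instances relate bisimilar terms. -/
def Sound (R : Set Rule) (t u : Tm) : Prop :=
  ∀ σ : ℕ → Tm, (∀ x, (σ x).Closed) → Bisim R (t.subst σ) (u.subst σ)

/-- Derivability from the axiom system `E` in equational logic. Terms are considered modulo
associativity and commutativity of `+`; the rules `plusComm` and `plusAssoc` express this. -/
inductive Derives (E : Set (Tm × Tm)) : Tm → Tm → Prop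
  | ax {t u : Tm} : (t, u) ∈ E → Derives E t u
  | refl (t : Tm) : Derives E t t
  | symm {t u : Tm} : Derives E t u → Derives E u t
  | trans {t u v : Tm} : Derives E t u → Derives E u v → Derives E t v
  | subst {t u : Tm} (σ : ℕ → Tm) : Derives E t u → Derives E (t.subst σ) (u.subst σ)
  | pre {t u : Tm} (μ : Act) : Derives E t u → Derives E (.pre μ t) (.pre μ u)
  | plus {t u t' u' : Tm} : Derives E t u → Derives E t' u' →
      Derives E (.plus t t') (.plus u u')
  | par {t u t' u' : Tm} : Derives E t u → Derives E t' u' →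
      Derives E (.par t t') (.par u u')
  | op {t u t' u' : Tm} : Derives E t u → Derives E t' u' →
      Derives E (.op t t') (.op u u')
  | plusComm (t u : Tm) : Derives E (.plus t u) (.plus u t)
  | plusAssoc (t u v : Tm) : Derives E (.plus (.plus t u) v) (.plus t (.plus u v))

/-- The three assumptions on `f`: its rules are in de Simone format, the equation
`x ∥ y ≈ f(x, y) + f(y, x)` is sound, and the target of each rule is a variable or one operator
applied to variables. -/
structure Admissible (R : Set Rule) : Prop where
  deSimone : ∀ r ∈ R, r.IsDeSimone
  sound_par : Sound R (.par (.var 0) (.var 1))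
    (.plus (.op (.var 0) (.var 1)) (.op (.var 1) (.var 0)))
  flat : ∀ r ∈ R, r.target.IsFlat

/-- From `x -α→ x'` infer `f(x, y) -α→ x' ∥ y`. -/
def leftRule (α : Vis) : Rule where
  prem₁ := some (.vis α)
  prem₂ := none
  act := .vis α
  target := .par (.var vx') (.var vy)

/-- From `y -α→ y'` infer `f(x, y) -α→ x ∥ y'`. -/
def rightRule (α : Vis) : Rule where
  prem₁ := none
  prem₂ := some (.vis α)
  act := .vis α
  target := .par (.var vx) (.var vy')

/-- The term `q_n`, the sum of `α.(ᾱ + ⋯ + ᾱⁱ)` over `i = 0, …, n`. -/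
def qn (α : Vis) (n : ℕ) : Tm :=
  sum ((List.range (n + 1)).map fun i => .pre (.vis α) (powLe (.vis α.bar) i))

/-- The term `f(α, q_n)`, the left-hand side of `ε_n`. -/
def epsLhs (α : Vis) (n : ℕ) : Tm := .op (.pre (.vis α) .zero) (qn α n)

/-- The right-hand side of `ε_n`: `α.q_n` plus the sum of `α.(α ∥ (ᾱ + ⋯ + ᾱⁱ))` over
`i = 0, …, n`. -/
def epsRhs (α : Vis) (n : ℕ) : Tm :=
  .plus (.pre (.vis α) (qn α n))
    (sum ((List.range (n + 1)).map fun i =>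
      .pre (.vis α) (.par (.pre (.vis α) .zero) (powLe (.vis α.bar) i))))

/-- The term is of the form `s₁ ∥ s₂` or `f(s₁, s₂)` with `s₁` or `s₂` bisimilar to `0`. -/
def HasZeroFactor (R : Set Rule) (s : Tm) : Prop :=
  ∃ s₁ s₂, (s = .par s₁ s₂ ∨ s = .op s₁ s₂) ∧ (Bisim R s₁ .zero ∨ Bisim R s₂ .zero)

end CCSf

/-! The proof finds an invariant of derivations, `Good`, that holds for the left-hand side of `ε_n`
and fails for the right-hand side.

By the equation x ∥ y ≈ f(x,y) + f(y,x), each transition of f(p,q) is one of p ∥ q; by the two rules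
for `α` the converse holds for `α`-transitions (`Interleaves.moveTo_op_iff`). So, as far as `α` is
concerned, f is parallel composition, and the invariant compares terms by their `α`-transitions
only. Both q_n and α are prime with respect to ∥, and α ∥ q_n is the only way to split a term with
the `α`-transitions of f(α, q_n) into two components that are not bisimilar to `0`
(`factors_of_sameMoves`).

The crucial case is an instance of an axiom t ≈ u with t smaller than n. The n + 1 different
`α`-derivatives of q_n are too many for t to produce with its own operators. Hence, if tσ is good,
an unguarded variable x of t is responsible: either σ(x) is itself good and everything in parallel
with x is bisimilar to `0`, or σ(x) contributes at least two derivatives of q_n and something in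
parallel with x is not bisimilar to `0` (`Good.exposed`). Both situations carry over to u: adding a
summand α.ᾱ^D with a huge D to σ(x) makes the unguarded occurrences of x observable, so by soundness
u has a matching occurrence of x (`Exposed.transfer`). From this occurrence uσ is seen to be good
(`Exposed.good_of_bisim_zero`, `Exposed.good_of_twoDown`).

An induction on derivations then gives invariance (`Derives.good_iff`). All summands of the
right-hand side of `ε_n` are prefixes, which are not good for n ≥ 1. -/

namespace CCSf

open Tm

variable {R : Set Rule} {α : Vis}

/-! ### Bisimilarity is a congruence -/

namespace Bisim

theorem refl (p : Tm) : Bisim R p p :=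
  ⟨Eq, fun _ _ h => h.symm, fun _ _ _ u' h hs => ⟨u', h ▸ hs, rfl⟩, rfl⟩

theorem symm {p q : Tm} (h : Bisim R p q) : Bisim R q p := by
  obtain ⟨S, h1, h2, h3⟩ := h
  exact ⟨S, h1, h2, h1 _ _ h3⟩

theorem step {p q p' : Tm} {μ : Act} (h : Bisim R p q) (hs : Step R p μ p') :
    ∃ q', Step R q μ q' ∧ Bisim R p' q' := by
  obtain ⟨S, h1, h2, h3⟩ := h
  obtain ⟨q', hq, hS⟩ := h2 _ _ _ _ h3 hs
  exact ⟨q', hq, S, h1, h2, hS⟩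

theorem trans {p q r : Tm} (h : Bisim R p q) (h' : Bisim R q r) : Bisim R p r := by
  refine ⟨fun u w => ∃ v, Bisim R u v ∧ Bisim R v w, ?_, ?_, q, h, h'⟩
  · rintro u w ⟨v, h1, h2⟩
    exact ⟨v, h2.symm, h1.symm⟩
  · rintro u w μ u' ⟨v, h1, h2⟩ hs
    obtain ⟨v', hv, h3⟩ := h1.step hs
    obtain ⟨w', hw, h4⟩ := h2.step hv
    exact ⟨w', hw, v', h3, h4⟩

end Bisim

/-- The congruence closure of bisimilarity. -/
inductive Cong (R : Set Rule) : Tm → Tm → Prop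
  | base {p q : Tm} : Bisim R p q → Cong R p q
  | pre (μ : Act) {p q : Tm} : Cong R p q → Cong R (.pre μ p) (.pre μ q)
  | plus {p q p' q' : Tm} : Cong R p q → Cong R p' q' → Cong R (.plus p p') (.plus q q')
  | par {p q p' q' : Tm} : Cong R p q → Cong R p' q' → Cong R (.par p p') (.par q q')
  | op {p q p' q' : Tm} : Cong R p q → Cong R p' q' → Cong R (.op p p') (.op q q')

namespace Cong

theorem symm {p q : Tm} (h : Cong R p q) : Cong R q p := by
  induction h with
  | base h => exact .base h.symm
  | pre μ _ ih => exact .pre μ ih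
  | plus _ _ ih1 ih2 => exact .plus ih1 ih2
  | par _ _ ih1 ih2 => exact .par ih1 ih2
  | op _ _ ih1 ih2 => exact .op ih1 ih2

theorem subst {σ τ : ℕ → Tm} (h : ∀ x, Cong R (σ x) (τ x)) (t : Tm) :
    Cong R (t.subst σ) (t.subst τ) := by
  induction t with
  | zero => exact .base (.refl _)
  | var x => exact h x
  | pre μ _ ih => exact .pre μ ih
  | plus _ _ ih1 ih2 => exact .plus ih1 ih2
  | par _ _ ih1 ih2 => exact .par ih1 ih2
  | op _ _ ih1 ih2 => exact .op ih1 ih2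

theorem step {p q : Tm} (h : Cong R p q) :
    ∀ {μ p'}, Step R p μ p' → ∃ q', Step R q μ q' ∧ Cong R p' q' := by
  induction h with
  | base h =>
    intro μ p' hs
    obtain ⟨q', hq, hb⟩ := h.step hs
    exact ⟨q', hq, .base hb⟩
  | pre μ h _ =>
    intro ν p' hs
    cases hs
    exact ⟨_, .pre _ _, h⟩
  | plus _ _ ih1 ih2 =>
    intro ν p' hs
    cases hs with
    | plusL hs =>
      obtain ⟨q', hq, hb⟩ := ih1 hs
      exact ⟨q', .plusL hq, hb⟩
    | plusR hs =>
      obtain ⟨q', hq, hb⟩ := ih2 hs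
      exact ⟨q', .plusR hq, hb⟩
  | par h1 h2 ih1 ih2 =>
    intro ν p' hs
    cases hs with
    | parL hs =>
      obtain ⟨q', hq, hb⟩ := ih1 hs
      exact ⟨_, .parL hq, .par hb h2⟩
    | parR hs =>
      obtain ⟨q', hq, hb⟩ := ih2 hs
      exact ⟨_, .parR hq, .par h1 hb⟩
    | sync hs hs' =>
      obtain ⟨q', hq, hb⟩ := ih1 hs
      obtain ⟨q'', hq', hb'⟩ := ih2 hs'
      exact ⟨_, .sync hq hq', .par hb hb'⟩
  | @op p q p₂ q₂ h1 h2 ih1 ih2 =>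
    intro ν w hs
    cases hs with
    | @op r _ _ p' p₂' hr hp1 hp2 =>
      obtain ⟨q', hq, hb⟩ :
          ∃ q', (∀ ν, r.prem₁ = some ν → Step R q ν q') ∧ Cong R p' q' := by
        cases hprem : r.prem₁ with
        -- Without a premise nothing constrains `p'`, so the same value serves on both sides.
        | none => exact ⟨p', by simp, .base (.refl _)⟩
        | some ν =>
          obtain ⟨q', hq, hb⟩ := ih1 (hp1 ν hprem)
          refine ⟨q', ?_, hb⟩
          rintro _ ⟨⟩
          exact hq
      obtain ⟨q₂', hq₂, hb₂⟩ :
          ∃ q₂', (∀ ν, r.prem₂ = some ν → Step R q₂ ν q₂') ∧ Cong R p₂' q₂' := by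
        cases hprem : r.prem₂ with
        | none => exact ⟨p₂', by simp, .base (.refl _)⟩
        | some ν =>
          obtain ⟨q', hq, hb⟩ := ih2 (hp2 ν hprem)
          refine ⟨q', ?_, hb⟩
          rintro _ ⟨⟩
          exact hq
      refine ⟨_, .op hr hq hq₂, subst ?_ _⟩
      intro x
      match x with
      | 0 => exact h1
      | 1 => exact h2
      | 2 => exact hb
      | 3 => exact hb₂
      | _ + 4 => exact .base (.refl _)

theorem bisim {p q : Tm} (h : Cong R p q) : Bisim R p q :=
  ⟨Cong R, fun _ _ h => h.symm, fun _ _ _ _ h hs => h.step hs, h⟩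

end Cong

namespace Bisim

theorem pre (μ : Act) {p q : Tm} (h : Bisim R p q) : Bisim R (.pre μ p) (.pre μ q) :=
  (Cong.pre μ (.base h)).bisim

theorem plus {p q p' q' : Tm} (h : Bisim R p q) (h' : Bisim R p' q') :
    Bisim R (.plus p p') (.plus q q') :=
  (Cong.plus (.base h) (.base h')).bisim

theorem par {p q p' q' : Tm} (h : Bisim R p q) (h' : Bisim R p' q') :
    Bisim R (.par p p') (.par q q') :=
  (Cong.par (.base h) (.base h')).bisim

theorem op {p q p' q' : Tm} (h : Bisim R p q) (h' : Bisim R p' q') :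
    Bisim R (.op p p') (.op q q') :=
  (Cong.op (.base h) (.base h')).bisim

theorem subst {σ τ : ℕ → Tm} (h : ∀ x, Bisim R (σ x) (τ x)) (t : Tm) :
    Bisim R (t.subst σ) (t.subst τ) :=
  (Cong.subst (fun x => .base (h x)) t).bisim

end Bisim

/-! ### Moves up to bisimilarity -/

/-- `p` has a `μ`-transition to a term bisimilar to `w`. -/
def MoveTo (R : Set Rule) (μ : Act) (p w : Tm) : Prop := ∃ w', Step R p μ w' ∧ Bisim R w' w

theorem Step.moveTo {μ : Act} {p w : Tm} (h : Step R p μ w) : MoveTo R μ p w := ⟨w, h, .refl _⟩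

theorem MoveTo.congr {μ : Act} {p q w v : Tm} (h : MoveTo R μ p w) (hp : Bisim R p q)
    (hw : Bisim R w v) : MoveTo R μ q v := by
  obtain ⟨w', hs, hb⟩ := h
  obtain ⟨v', hs', hb'⟩ := hp.step hs
  exact ⟨v', hs', hb'.symm.trans (hb.trans hw)⟩

theorem MoveTo.left {μ : Act} {p q w : Tm} (h : MoveTo R μ p w) (hp : Bisim R p q) :
    MoveTo R μ q w := h.congr hp (.refl _)

theorem MoveTo.right {μ : Act} {p w v : Tm} (h : MoveTo R μ p w) (hw : Bisim R w v) :
    MoveTo R μ p v := h.congr (.refl _) hw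

/-- Bisimilarity itself has to be added to the relation, since the derivatives are already
bisimilar. -/
theorem bisim_of_moveTo {p q : Tm} (h : ∀ μ w, MoveTo R μ p w ↔ MoveTo R μ q w) :
    Bisim R p q := by
  refine ⟨fun u v => Bisim R u v ∨ ∀ μ w, MoveTo R μ u w ↔ MoveTo R μ v w, ?_, ?_, .inr h⟩
  · rintro u v (h | h)
    · exact .inl h.symm
    · exact .inr fun μ w => (h μ w).symm
  · rintro u v μ u' (h | h) hs
    · obtain ⟨v', hv, hb⟩ := h.step hs
      exact ⟨v', hv, .inl hb⟩
    · obtain ⟨v', hv, hb⟩ := (h μ u').1 hs.moveTo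
      exact ⟨v', hv, .inl hb.symm⟩

theorem not_moveTo_zero {μ : Act} {w : Tm} : ¬ MoveTo R μ .zero w := by
  rintro ⟨_, h, _⟩
  cases h

theorem not_moveTo_var {μ : Act} {w : Tm} {x : ℕ} : ¬ MoveTo R μ (.var x) w := by
  rintro ⟨_, h, _⟩
  cases h

theorem moveTo_pre {μ ν : Act} {p w : Tm} :
    MoveTo R ν (.pre μ p) w ↔ ν = μ ∧ Bisim R p w := by
  constructor
  · rintro ⟨w', h, hb⟩
    cases h
    exact ⟨rfl, hb⟩
  · rintro ⟨rfl, hb⟩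
    exact ⟨p, .pre _ _, hb⟩

theorem moveTo_plus {μ : Act} {p q w : Tm} :
    MoveTo R μ (.plus p q) w ↔ MoveTo R μ p w ∨ MoveTo R μ q w := by
  constructor
  · rintro ⟨w', h, hb⟩
    cases h with
    | plusL h => exact .inl ⟨w', h, hb⟩
    | plusR h => exact .inr ⟨w', h, hb⟩
  · rintro (⟨w', h, hb⟩ | ⟨w', h, hb⟩)
    · exact ⟨w', .plusL h, hb⟩
    · exact ⟨w', .plusR h, hb⟩

theorem moveTo_sum {μ : Act} {w : Tm} {l : List Tm} :
    MoveTo R μ (Tm.sum l) w ↔ ∃ t ∈ l, MoveTo R μ t w := by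
  induction l with
  | nil => simp [Tm.sum, not_moveTo_zero]
  | cons t l ih =>
    cases l with
    | nil => simp [Tm.sum]
    | cons u l => rw [Tm.sum, moveTo_plus, ih]; simp

theorem MoveTo.parL {μ : Act} {p p' : Tm} (h : MoveTo R μ p p') (q : Tm) :
    MoveTo R μ (.par p q) (.par p' q) := by
  obtain ⟨w, h, hb⟩ := h
  exact ⟨_, .parL h, hb.par (.refl _)⟩

theorem MoveTo.parR {μ : Act} {q q' : Tm} (h : MoveTo R μ q q') (p : Tm) :
    MoveTo R μ (.par p q) (.par p q') := by
  obtain ⟨w, h, hb⟩ := h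
  exact ⟨_, .parR h, (Bisim.refl _).par hb⟩

theorem moveTo_par_vis {β : Vis} {p q w : Tm} :
    MoveTo R (.vis β) (.par p q) w ↔
      (∃ p', MoveTo R (.vis β) p p' ∧ Bisim R (.par p' q) w) ∨
      (∃ q', MoveTo R (.vis β) q q' ∧ Bisim R (.par p q') w) := by
  constructor
  · rintro ⟨w', h, hb⟩
    cases h with
    | parL h => exact .inl ⟨_, h.moveTo, hb⟩
    | parR h => exact .inr ⟨_, h.moveTo, hb⟩
  · rintro (⟨p', h, hb⟩ | ⟨q', h, hb⟩)
    · exact (h.parL q).right hb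
    · exact (h.parR p).right hb

theorem bisim_zero_iff {p : Tm} : Bisim R p .zero ↔ ∀ μ w, ¬ MoveTo R μ p w := by
  constructor
  · intro h μ w hm
    exact not_moveTo_zero (hm.left h)
  · intro h
    exact bisim_of_moveTo fun μ w => ⟨fun hm => (h μ w hm).elim, fun hm => (not_moveTo_zero hm).elim⟩

theorem bisim_var_zero (x : ℕ) : Bisim R (.var x) .zero :=
  bisim_zero_iff.2 fun _ _ => not_moveTo_var

theorem Bisim.zero_congr {p q : Tm} (h : Bisim R p q) :
    Bisim R p .zero ↔ Bisim R q .zero :=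
  ⟨fun hp => h.symm.trans hp, fun hq => h.trans hq⟩

/-! ### Parallel composition modulo bisimilarity -/

theorem Vis.bar_bar (β : Vis) : β.bar.bar = β := by cases β <;> rfl

theorem Vis.bar_ne (β : Vis) : β.bar ≠ β := by cases β <;> nofun

theorem par_comm_bisim (p q : Tm) : Bisim R (.par p q) (.par q p) := by
  refine ⟨fun u v => ∃ p q, u = .par p q ∧ v = .par q p, ?_, ?_, p, q, rfl, rfl⟩
  · rintro _ _ ⟨p, q, rfl, rfl⟩
    exact ⟨q, p, rfl, rfl⟩
  · rintro _ _ μ u' ⟨p, q, rfl, rfl⟩ hs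
    cases hs with
    | parL h => exact ⟨_, .parR h, _, _, rfl, rfl⟩
    | parR h => exact ⟨_, .parL h, _, _, rfl, rfl⟩
    | @sync _ _ _ _ β h h' =>
      exact ⟨_, .sync (α := β.bar) h' (by rwa [Vis.bar_bar]), _, _, rfl, rfl⟩

theorem par_zero_bisim (p : Tm) : Bisim R (.par p .zero) p := by
  refine ⟨fun u v => u = .par v .zero ∨ v = .par u .zero, ?_, ?_, .inl rfl⟩
  · rintro _ _ (h | h)
    · exact .inr h
    · exact .inl h
  · rintro u v μ u' (rfl | rfl) hs
    · cases hs with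
      | parL h => exact ⟨_, h, .inl rfl⟩
      | parR h => cases h
      | sync _ h => cases h
    · exact ⟨_, .parL hs, .inr rfl⟩

theorem zero_par_bisim (p : Tm) : Bisim R (.par .zero p) p :=
  (par_comm_bisim _ _).trans (par_zero_bisim p)

theorem par_assoc_bisim (p q r : Tm) : Bisim R (.par (.par p q) r) (.par p (.par q r)) := by
  refine ⟨fun u v => ∃ p q r, (u = .par (.par p q) r ∧ v = .par p (.par q r)) ∨
    (v = .par (.par p q) r ∧ u = .par p (.par q r)), ?_, ?_, p, q, r, .inl ⟨rfl, rfl⟩⟩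
  · rintro _ _ ⟨p, q, r, h⟩
    exact ⟨p, q, r, h.symm⟩
  · rintro u v μ u' ⟨p, q, r, ⟨rfl, rfl⟩ | ⟨rfl, rfl⟩⟩ hs
    · cases hs with
      | parL h =>
        cases h with
        | parL h => exact ⟨_, .parL h, _, _, _, .inl ⟨rfl, rfl⟩⟩
        | parR h => exact ⟨_, .parR (.parL h), _, _, _, .inl ⟨rfl, rfl⟩⟩
        | sync h h' => exact ⟨_, .sync h (.parL h'), _, _, _, .inl ⟨rfl, rfl⟩⟩
      | parR h => exact ⟨_, .parR (.parR h), _, _, _, .inl ⟨rfl, rfl⟩⟩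
      | sync h h' =>
        cases h with
        | parL h => exact ⟨_, .sync h (.parR h'), _, _, _, .inl ⟨rfl, rfl⟩⟩
        | parR h => exact ⟨_, .parR (.sync h h'), _, _, _, .inl ⟨rfl, rfl⟩⟩
    · cases hs with
      | parR h =>
        cases h with
        | parL h => exact ⟨_, .parL (.parR h), _, _, _, .inr ⟨rfl, rfl⟩⟩
        | parR h => exact ⟨_, .parR h, _, _, _, .inr ⟨rfl, rfl⟩⟩
        | sync h h' => exact ⟨_, .sync (.parR h) h', _, _, _, .inr ⟨rfl, rfl⟩⟩
      | parL h => exact ⟨_, .parL (.parL h), _, _, _, .inr ⟨rfl, rfl⟩⟩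
      | sync h h' =>
        cases h' with
        | parL h' => exact ⟨_, .parL (.sync h h'), _, _, _, .inr ⟨rfl, rfl⟩⟩
        | parR h' => exact ⟨_, .sync (.parL h) h', _, _, _, .inr ⟨rfl, rfl⟩⟩

theorem par_bisim_left {p q : Tm} (h : Bisim R q .zero) : Bisim R (.par p q) p :=
  ((Bisim.refl p).par h).trans (par_zero_bisim p)

theorem par_bisim_right {p q : Tm} (h : Bisim R p .zero) : Bisim R (.par p q) q :=
  (h.par (Bisim.refl q)).trans (zero_par_bisim q)

theorem par_bisim_zero {p q : Tm} :
    Bisim R (.par p q) .zero ↔ Bisim R p .zero ∧ Bisim R q .zero := by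
  constructor
  · intro h
    rw [bisim_zero_iff] at h
    exact ⟨bisim_zero_iff.2 fun μ w hm => h _ _ (hm.parL q),
      bisim_zero_iff.2 fun μ w hm => h _ _ (hm.parR p)⟩
  · rintro ⟨h, h'⟩
    exact (par_bisim_left h').trans h

/-! ### Closing terms; consequences of the assumptions on `f` -/

/-- Variables have no transitions and so behave like `0`. Thus the open terms that occur in
derivations need no separate treatment. -/
theorem bisim_close (p : Tm) : Bisim R p (p.subst fun _ => .zero) := by
  induction p with
  | zero => exact .refl _
  | var x => exact bisim_var_zero x
  | pre μ _ ih => exact .pre μ ih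
  | plus _ _ ih1 ih2 => exact .plus ih1 ih2
  | par _ _ ih1 ih2 => exact .par ih1 ih2
  | op _ _ ih1 ih2 => exact .op ih1 ih2

theorem closed_close (p : Tm) : (p.subst fun _ => .zero).Closed := by
  intro x
  induction p with
  | zero => rfl
  | var => rfl
  | pre μ _ ih => exact ih
  | plus _ _ ih1 ih2 => simp [Tm.subst, Tm.occ, ih1, ih2]
  | par _ _ ih1 ih2 => simp [Tm.subst, Tm.occ, ih1, ih2]
  | op _ _ ih1 ih2 => simp [Tm.subst, Tm.occ, ih1, ih2]

/-- Open instances of sound equations relate bisimilar terms, too. -/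
theorem Sound.bisim_subst {t u : Tm} (h : Sound R t u) (σ : ℕ → Tm) :
    Bisim R (t.subst σ) (u.subst σ) :=
  ((Bisim.subst (fun x => bisim_close (σ x)) t).trans
    (h _ fun x => closed_close (σ x))).trans (Bisim.subst (fun x => bisim_close (σ x)) u).symm

theorem subst_subst (σ τ : ℕ → Tm) (t : Tm) :
    (t.subst σ).subst τ = t.subst fun x => (σ x).subst τ := by
  induction t with
  | zero => rfl
  | var => rfl
  | pre μ _ ih => simp [Tm.subst, ih]
  | plus _ _ ih1 ih2 => simp [Tm.subst, ih1, ih2]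
  | par _ _ ih1 ih2 => simp [Tm.subst, ih1, ih2]
  | op _ _ ih1 ih2 => simp [Tm.subst, ih1, ih2]

theorem subst_of_closed (σ : ℕ → Tm) {t : Tm} (h : t.Closed) : t.subst σ = t := by
  induction t with
  | zero => rfl
  | var x => simpa [Tm.occ] using h x
  | pre μ _ ih => simp only [Tm.subst, ih h]
  | plus _ _ ih1 ih2 | par _ _ ih1 ih2 | op _ _ ih1 ih2 =>
    simp only [Tm.subst, ih1 fun x => (Nat.add_eq_zero_iff.1 (h x)).1,
      ih2 fun x => (Nat.add_eq_zero_iff.1 (h x)).2]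

theorem Derives.bisim_subst {E : Set (Tm × Tm)} (hE : ∀ e ∈ E, Sound R e.1 e.2) {t u : Tm}
    (h : Derives E t u) (σ : ℕ → Tm) : Bisim R (t.subst σ) (u.subst σ) := by
  induction h generalizing σ with
  | ax h => exact (hE _ h).bisim_subst σ
  | refl => exact .refl _
  | symm _ ih => exact (ih σ).symm
  | trans _ _ ih1 ih2 => exact (ih1 σ).trans (ih2 σ)
  | subst τ _ ih => simpa only [subst_subst] using ih _
  | pre μ _ ih => exact (ih σ).pre μ
  | plus _ _ ih1 ih2 => exact (ih1 σ).plus (ih2 σ)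
  | par _ _ ih1 ih2 => exact (ih1 σ).par (ih2 σ)
  | op _ _ ih1 ih2 => exact (ih1 σ).op (ih2 σ)
  | plusComm t u =>
    exact bisim_of_moveTo fun μ w => by simp only [Tm.subst, moveTo_plus, or_comm]
  | plusAssoc t u v =>
    exact bisim_of_moveTo fun μ w => by simp only [Tm.subst, moveTo_plus, or_assoc]

/-- The assumptions on `f`, together with the two rules for the action `α`. -/
structure Interleaves (R : Set Rule) (α : Vis) : Prop extends Admissible R where
  left_mem : leftRule α ∈ R
  right_mem : rightRule α ∈ R

theorem Admissible.par_bisim (hR : Admissible R) (p q : Tm) :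
    Bisim R (.par p q) (.plus (.op p q) (.op q p)) :=
  hR.sound_par.bisim_subst (fun x => if x = 0 then p else q)

theorem Admissible.moveTo_par (hR : Admissible R) {μ : Act} {p q w : Tm}
    (h : MoveTo R μ (.op p q) w) : MoveTo R μ (.par p q) w :=
  (moveTo_plus.2 (.inl h)).left (hR.par_bisim p q).symm

/-- One direction is the equation for ∥, the other is given by the two rules. For actions other than
`α` only the first direction is available. -/
theorem Interleaves.moveTo_op_iff (hI : Interleaves R α) {p q w : Tm} :
    MoveTo R (.vis α) (.op p q) w ↔ MoveTo R (.vis α) (.par p q) w := by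
  refine ⟨hI.toAdmissible.moveTo_par, fun ⟨w', hs, hb⟩ => ?_⟩
  cases hs with
  | @parL _ _ p' _ h =>
    -- The rule has no premise on y and its target does not contain y', so the value `zero` is
    -- arbitrary.
    refine ⟨_, .op (p' := p') (q' := .zero) hI.left_mem ?_ ?_, hb⟩
    · rintro _ ⟨⟩
      exact h
    · rintro _ ⟨⟩
  | @parR _ _ q' _ h =>
    refine ⟨_, .op (p' := .zero) (q' := q') hI.right_mem ?_ ?_, hb⟩
    · rintro _ ⟨⟩
    · rintro _ ⟨⟩
      exact h

/-! ### Traces of a single visible action -/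

/-- `p` can perform the visible action `β` at least `k` times in a row. -/
def HasTrace (R : Set Rule) (β : Vis) : ℕ → Tm → Prop
  | 0, _ => True
  | k + 1, p => ∃ p', MoveTo R (.vis β) p p' ∧ HasTrace R β k p'

theorem HasTrace.congr {β : Vis} {k : ℕ} {p q : Tm} (h : HasTrace R β k p) (hb : Bisim R p q) :
    HasTrace R β k q := by
  cases k with
  | zero => trivial
  | succ k =>
    obtain ⟨p', hm, ht⟩ := h
    exact ⟨p', hm.left hb, ht⟩

theorem HasTrace.par {β : Vis} {i j : ℕ} {p q : Tm} (hp : HasTrace R β i p)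
    (hq : HasTrace R β j q) : HasTrace R β (i + j) (.par p q) := by
  induction i generalizing p with
  | zero =>
    induction j generalizing q with
    | zero => trivial
    | succ j ih =>
      obtain ⟨q', hm, ht⟩ := hq
      exact ⟨_, hm.parR p, ih ht⟩
  | succ i ih =>
    obtain ⟨p', hm, ht⟩ := hp
    rw [Nat.succ_add]
    exact ⟨_, hm.parL q, ih ht⟩

theorem HasTrace.of_par {β : Vis} {k : ℕ} {p q : Tm} (h : HasTrace R β k (.par p q)) :
    ∃ i j, i + j = k ∧ HasTrace R β i p ∧ HasTrace R β j q := by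
  induction k generalizing p q with
  | zero => exact ⟨0, 0, rfl, trivial, trivial⟩
  | succ k ih =>
    obtain ⟨w, hm, ht⟩ := h
    rcases moveTo_par_vis.1 hm with ⟨p', hm, hb⟩ | ⟨q', hm, hb⟩
    · obtain ⟨i, j, hij, hi, hj⟩ := ih (ht.congr hb.symm)
      exact ⟨i + 1, j, by omega, ⟨p', hm, hi⟩, hj⟩
    · obtain ⟨i, j, hij, hi, hj⟩ := ih (ht.congr hb.symm)
      exact ⟨i, j + 1, by omega, hi, q', hm, hj⟩

theorem Admissible.hasTrace_par (hR : Admissible R) {β : Vis} {k : ℕ} {p q : Tm}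
    (h : HasTrace R β k (.op p q)) : HasTrace R β k (.par p q) := by
  cases k with
  | zero => trivial
  | succ k =>
    obtain ⟨w, hm, ht⟩ := h
    exact ⟨w, hR.moveTo_par hm, ht⟩

theorem hasTrace_plus {β : Vis} {k : ℕ} {p q : Tm} (h : HasTrace R β k (.plus p q)) :
    HasTrace R β k p ∨ HasTrace R β k q := by
  cases k with
  | zero => exact .inl trivial
  | succ k =>
    obtain ⟨w, hm, ht⟩ := h
    exact (moveTo_plus.1 hm).imp (fun hm => ⟨w, hm, ht⟩) fun hm => ⟨w, hm, ht⟩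

theorem hasTrace_zero {β : Vis} {k : ℕ} (h : HasTrace R β k .zero) : k = 0 := by
  cases k with
  | zero => rfl
  | succ k =>
    obtain ⟨w, hm, -⟩ := h
    exact (not_moveTo_zero hm).elim

theorem hasTrace_pre {β : Vis} {μ : Act} {k : ℕ} {p : Tm} (h : HasTrace R β k (.pre μ p)) :
    k = 0 ∨ μ = .vis β ∧ ∃ j, k = j + 1 ∧ HasTrace R β j p := by
  cases k with
  | zero => exact .inl rfl
  | succ k =>
    obtain ⟨w, hm, ht⟩ := h
    obtain ⟨hμ, hb⟩ := moveTo_pre.1 hm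
    exact .inr ⟨hμ.symm, k, rfl, ht.congr hb.symm⟩

/-- The lengths of the `β`-traces of an instance under `σ'` are bounded by the size of the instance
under `σ` if this holds for the values of `σ'`. -/
theorem hasTrace_le_size_of_subst (hR : Admissible R) {β : Vis} {σ σ' : ℕ → Tm}
    (hσ : ∀ x k, HasTrace R β k (σ' x) → k ≤ (σ x).size) (t : Tm) :
    ∀ k, HasTrace R β k (t.subst σ') → k ≤ (t.subst σ).size := by
  induction t with
  | zero => exact fun k h => (hasTrace_zero h).le.trans (Nat.zero_le _)
  | var x => exact hσ x
  | pre μ t ih =>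
    intro k h
    rcases hasTrace_pre h with rfl | ⟨-, j, rfl, ht⟩
    · exact Nat.zero_le _
    · exact Nat.succ_le_succ (ih j ht)
  | plus t u ih1 ih2 =>
    intro k h
    simp only [Tm.subst, Tm.size]
    rcases hasTrace_plus h with h | h
    · have := ih1 k h
      omega
    · have := ih2 k h
      omega
  | par t u ih1 ih2 =>
    intro k h
    simp only [Tm.subst, Tm.size]
    obtain ⟨i, j, rfl, hi, hj⟩ := h.of_par
    have := ih1 i hi
    have := ih2 j hj
    omega
  | op t u ih1 ih2 =>
    intro k h
    simp only [Tm.subst, Tm.size]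
    obtain ⟨i, j, rfl, hi, hj⟩ := (hR.hasTrace_par h).of_par
    have := ih1 i hi
    have := ih2 j hj
    omega

theorem subst_var (t : Tm) : t.subst .var = t := by
  induction t with
  | zero => rfl
  | var => rfl
  | pre μ _ ih => simp [Tm.subst, ih]
  | plus _ _ ih1 ih2 | par _ _ ih1 ih2 | op _ _ ih1 ih2 => simp [Tm.subst, ih1, ih2]

theorem hasTrace_le_size (hR : Admissible R) {β : Vis} {k : ℕ} {p : Tm}
    (h : HasTrace R β k p) : k ≤ p.size := by
  have := hasTrace_le_size_of_subst hR (σ := .var) (σ' := .var) (β := β)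
    (fun x k h => (hasTrace_zero (h.congr (bisim_var_zero x))).le) p k
  rw [subst_var] at this
  exact this h

theorem hasTrace_le_size_of_moveTo (hR : Admissible R) {β γ : Vis} {p : Tm} :
    ∀ {k w}, MoveTo R (.vis γ) p w → HasTrace R β k w → k ≤ p.size := by
  induction p with
  | zero => exact fun hm => (not_moveTo_zero hm).elim
  | var x => exact fun hm => (not_moveTo_var hm).elim
  | pre μ p _ =>
    intro k w hm h
    exact (hasTrace_le_size hR (h.congr (moveTo_pre.1 hm).2.symm)).trans (Nat.le_succ _)
  | plus p q ih1 ih2 =>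
    intro k w hm h
    simp only [Tm.size]
    rcases moveTo_plus.1 hm with hm | hm
    · have := ih1 hm h
      omega
    · have := ih2 hm h
      omega
  | par p q ih1 ih2 | op p q ih1 ih2 =>
    intro k w hm h
    simp only [Tm.size]
    have hm : MoveTo R (.vis γ) (.par p q) w := by
      first
        | exact hm
        | exact hR.moveTo_par hm
    rcases moveTo_par_vis.1 hm with ⟨p', hm, hb⟩ | ⟨q', hm, hb⟩ <;>
      obtain ⟨i, j, rfl, hi, hj⟩ := (h.congr hb.symm).of_par
    · have := ih1 hm hi
      have := hasTrace_le_size hR hj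
      omega
    · have := ih2 hm hj
      have := hasTrace_le_size hR hi
      omega

/-! ### Powers -/

theorem moveTo_pow {μ ν : Act} {m : ℕ} {w : Tm} :
    MoveTo R ν (pow μ m) w ↔ ν = μ ∧ ∃ j, m = j + 1 ∧ Bisim R w (pow μ j) := by
  cases m with
  | zero => simp [pow, not_moveTo_zero]
  | succ m =>
    rw [pow, moveTo_pre]
    simp only [Nat.add_right_cancel_iff, exists_eq_left']
    exact and_congr_right fun _ => ⟨.symm, .symm⟩

theorem hasTrace_pow {β : Vis} {k m : ℕ} : HasTrace R β k (pow (.vis β) m) ↔ k ≤ m := by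
  induction k generalizing m with
  | zero => simp [HasTrace]
  | succ k ih =>
    constructor
    · rintro ⟨w, hm, ht⟩
      obtain ⟨-, j, rfl, hb⟩ := moveTo_pow.1 hm
      exact Nat.succ_le_succ (ih.1 (ht.congr hb))
    · intro h
      obtain ⟨j, rfl⟩ : ∃ j, m = j + 1 := ⟨m - 1, by omega⟩
      exact ⟨_, (Step.pre _ _).moveTo, ih.2 (by omega)⟩

/-! ### Exposed variables -/

/-- The variable `x` occurs in `t` outside the scope of every prefix, and `r` is the parallel
composition of the components of `t` that run in parallel with this occurrence. -/
inductive Exposed (x : ℕ) : Tm → Tm → Prop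
  | var : Exposed x (.var x) .zero
  | plusL {t r : Tm} (u : Tm) : Exposed x t r → Exposed x (.plus t u) r
  | plusR {u r : Tm} (t : Tm) : Exposed x u r → Exposed x (.plus t u) r
  | parL {t r : Tm} (u : Tm) : Exposed x t r → Exposed x (.par t u) (.par r u)
  | parR {u r : Tm} (t : Tm) : Exposed x u r → Exposed x (.par t u) (.par r t)
  | opL {t r : Tm} (u : Tm) : Exposed x t r → Exposed x (.op t u) (.par r u)
  | opR {u r : Tm} (t : Tm) : Exposed x u r → Exposed x (.op t u) (.par r t)

theorem par_left_comm_bisim (p q r : Tm) :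
    Bisim R (.par r (.par p q)) (.par p (.par q r)) :=
  (par_comm_bisim _ _).trans (par_assoc_bisim p q r)

/-- The transitions of an exposed variable are transitions of the whole term. -/
theorem Exposed.moveTo (hI : Interleaves R α) {x : ℕ} {t r : Tm} (h : Exposed x t r)
    {σ : ℕ → Tm} {w : Tm} (hm : MoveTo R (.vis α) (σ x) w) :
    MoveTo R (.vis α) (t.subst σ) (.par w (r.subst σ)) := by
  induction h with
  | var => exact hm.right (par_zero_bisim w).symm
  | plusL u _ ih => exact moveTo_plus.2 (.inl ih)
  | plusR t _ ih => exact moveTo_plus.2 (.inr ih)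
  | parL u _ ih => exact (ih.parL _).right (par_assoc_bisim _ _ _)
  | parR t _ ih => exact (ih.parR _).right (par_left_comm_bisim _ _ _)
  | opL u _ ih => exact hI.moveTo_op_iff.2 ((ih.parL _).right (par_assoc_bisim _ _ _))
  | opR t _ ih => exact hI.moveTo_op_iff.2 ((ih.parR _).right (par_left_comm_bisim _ _ _))

/-- The substitution that adds a summand `α.ᾱ^D` to the value of `x`. -/
def mark (α : Vis) (D x : ℕ) (σ : ℕ → Tm) : ℕ → Tm :=
  Function.update σ x (.plus (σ x) (.pre (.vis α) (pow (.vis α.bar) D)))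

theorem mark_self (α : Vis) (D x : ℕ) (σ : ℕ → Tm) :
    mark α D x σ x = .plus (σ x) (.pre (.vis α) (pow (.vis α.bar) D)) :=
  Function.update_self ..

theorem mark_of_ne (α : Vis) (D : ℕ) {x y : ℕ} (h : y ≠ x) (σ : ℕ → Tm) :
    mark α D x σ y = σ y :=
  Function.update_of_ne h ..

/-- The summand added by `mark` starts with `α` and so contributes nothing to `ᾱ`-traces. Hence the
bound does not depend on `D`. -/
theorem hasTrace_mark (hR : Admissible R) {D x : ℕ} {σ : ℕ → Tm} (t : Tm) {k : ℕ}
    (h : HasTrace R α.bar k (t.subst (mark α D x σ))) : k ≤ (t.subst σ).size := by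
  refine hasTrace_le_size_of_subst hR (fun y k h => ?_) t k h
  by_cases hy : y = x
  · subst hy
    rw [mark_self] at h
    rcases hasTrace_plus h with h | h
    · exact hasTrace_le_size hR h
    · rcases hasTrace_pre h with rfl | ⟨h, -⟩
      · exact Nat.zero_le _
      · exact (α.bar_ne (by injection h with h; exact h.symm)).elim
  · rw [mark_of_ne _ _ hy] at h
    exact hasTrace_le_size hR h

/-- An `α`-transition of an instance under `mark` leads to a term with bounded `ᾱ`-traces, unless
it stems from the additional summand. -/
theorem moveTo_mark (hR : Admissible R) {D x : ℕ} {σ : ℕ → Tm} (t : Tm) :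
    ∀ {w}, MoveTo R (.vis α) (t.subst (mark α D x σ)) w →
      (∃ r, Exposed x t r ∧
        Bisim R w (.par (pow (.vis α.bar) D) (r.subst (mark α D x σ)))) ∨
      ∀ k, HasTrace R α.bar k w → k ≤ (t.subst σ).size := by
  induction t with
  | zero => exact fun hm => (not_moveTo_zero hm).elim
  | var y =>
    intro w hm
    simp only [Tm.subst] at hm ⊢
    by_cases hy : y = x
    · subst hy
      rw [mark_self] at hm
      rcases moveTo_plus.1 hm with hm | hm
      · exact .inr fun k h => hasTrace_le_size_of_moveTo hR hm h
      · exact .inl ⟨_, .var, (moveTo_pre.1 hm).2.symm.trans (par_zero_bisim _).symm⟩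
    · rw [mark_of_ne _ _ hy] at hm
      exact .inr fun k h => hasTrace_le_size_of_moveTo hR hm h
  | pre μ t _ =>
    intro w hm
    refine .inr fun k h => ?_
    exact (hasTrace_mark hR t (h.congr (moveTo_pre.1 hm).2.symm)).trans (Nat.le_succ _)
  | plus t u ih1 ih2 =>
    intro w hm
    simp only [Tm.subst, Tm.size]
    rcases moveTo_plus.1 hm with hm | hm
    · rcases ih1 hm with ⟨r, h, hb⟩ | h
      · exact .inl ⟨r, .plusL u h, hb⟩
      · exact .inr fun k hk => (h k hk).trans (by omega)
    · rcases ih2 hm with ⟨r, h, hb⟩ | h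
      · exact .inl ⟨r, .plusR t h, hb⟩
      · exact .inr fun k hk => (h k hk).trans (by omega)
  | par t u ih1 ih2 | op t u ih1 ih2 =>
    intro w hm
    simp only [Tm.subst, Tm.size]
    have hm : MoveTo R (.vis α)
        (.par (t.subst (mark α D x σ)) (u.subst (mark α D x σ))) w := by
      first
        | exact hm
        | exact hR.moveTo_par hm
    rcases moveTo_par_vis.1 hm with ⟨p', hm, hb⟩ | ⟨q', hm, hb⟩
    · rcases ih1 hm with ⟨r, h, hb'⟩ | h
      · refine .inl ⟨.par r u, by first | exact .parL u h | exact .opL u h, ?_⟩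
        exact (hb.symm.trans (hb'.par (.refl _))).trans (par_assoc_bisim _ _ _)
      · refine .inr fun k hk => ?_
        obtain ⟨i, j, rfl, hi, hj⟩ := (hk.congr hb.symm).of_par
        have := h i hi
        have := hasTrace_mark hR u hj
        omega
    · rcases ih2 hm with ⟨r, h, hb'⟩ | h
      · refine .inl ⟨.par r t, by first | exact .parR t h | exact .opR t h, ?_⟩
        exact (hb.symm.trans ((Bisim.refl _).par hb')).trans (par_left_comm_bisim _ _ _)
      · refine .inr fun k hk => ?_
        obtain ⟨i, j, rfl, hi, hj⟩ := (hk.congr hb.symm).of_par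
        have := h j hj
        have := hasTrace_mark hR t hi
        omega

/-! ### Initial actions -/

/-- The initial actions of an instance depend on the initial actions of the substitution only. -/
theorem initial_subst {σ τ : ℕ → Tm}
    (h : ∀ x μ, (∃ w, Step R (σ x) μ w) → ∃ w, Step R (τ x) μ w) (t : Tm) :
    ∀ μ, (∃ w, Step R (t.subst σ) μ w) → ∃ w, Step R (t.subst τ) μ w := by
  induction t with
  | zero => exact fun _ h => h
  | var x => exact h x
  | pre μ t _ =>
    rintro _ ⟨_, ⟨⟩⟩
    exact ⟨_, .pre _ _⟩
  | plus t u ih1 ih2 =>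
    rintro _ ⟨_, hs⟩
    cases hs with
    | plusL hs =>
      obtain ⟨w, hw⟩ := ih1 _ ⟨_, hs⟩
      exact ⟨_, .plusL hw⟩
    | plusR hs =>
      obtain ⟨w, hw⟩ := ih2 _ ⟨_, hs⟩
      exact ⟨_, .plusR hw⟩
  | par t u ih1 ih2 =>
    rintro _ ⟨_, hs⟩
    cases hs with
    | parL hs =>
      obtain ⟨w, hw⟩ := ih1 _ ⟨_, hs⟩
      exact ⟨_, .parL hw⟩
    | parR hs =>
      obtain ⟨w, hw⟩ := ih2 _ ⟨_, hs⟩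
      exact ⟨_, .parR hw⟩
    | sync hs hs' =>
      obtain ⟨w, hw⟩ := ih1 _ ⟨_, hs⟩
      obtain ⟨w', hw'⟩ := ih2 _ ⟨_, hs'⟩
      exact ⟨_, .sync hw hw'⟩
  | op t u ih1 ih2 =>
    rintro _ ⟨_, hs⟩
    cases hs with
    | @op r _ _ p' q' hr hp hq =>
      obtain ⟨p'', hp''⟩ : ∃ p'', ∀ ν, r.prem₁ = some ν → Step R (t.subst τ) ν p'' := by
        cases hprem : r.prem₁ with
        | none => exact ⟨.zero, by simp⟩
        | some ν =>
          obtain ⟨w, hw⟩ := ih1 ν ⟨_, hp ν hprem⟩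
          exact ⟨w, by rintro _ ⟨⟩; exact hw⟩
      obtain ⟨q'', hq''⟩ : ∃ q'', ∀ ν, r.prem₂ = some ν → Step R (u.subst τ) ν q'' := by
        cases hprem : r.prem₂ with
        | none => exact ⟨.zero, by simp⟩
        | some ν =>
          obtain ⟨w, hw⟩ := ih2 ν ⟨_, hq ν hprem⟩
          exact ⟨w, by rintro _ ⟨⟩; exact hw⟩
      exact ⟨_, .op hr hp'' hq''⟩

theorem bisim_zero_iff_step {p : Tm} : Bisim R p .zero ↔ ¬ ∃ μ w, Step R p μ w := by
  rw [bisim_zero_iff]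
  constructor
  · rintro h ⟨μ, w, hs⟩
    exact h μ w hs.moveTo
  · rintro h μ w ⟨w', hs, -⟩
    exact h ⟨μ, w', hs⟩

/-- Since `σ x` can already perform `α`, marking does not change its initial actions, and these
alone decide whether an instance is bisimilar to `0`. -/
theorem subst_mark_bisim_zero {D x : ℕ} {σ : ℕ → Tm} {w : Tm}
    (hx : MoveTo R (.vis α) (σ x) w) (t : Tm) :
    Bisim R (t.subst (mark α D x σ)) .zero ↔ Bisim R (t.subst σ) .zero := by
  rw [bisim_zero_iff_step, bisim_zero_iff_step, not_iff_not]
  constructor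
  · rintro ⟨μ, h⟩
    refine ⟨μ, initial_subst (fun y ν h => ?_) t μ h⟩
    by_cases hy : y = x
    · subst hy
      obtain ⟨w', h⟩ := h
      rw [mark_self] at h
      cases h with
      | plusL h => exact ⟨_, h⟩
      | plusR h =>
        cases h
        obtain ⟨w', h, -⟩ := hx
        exact ⟨_, h⟩
    · rwa [mark_of_ne _ _ hy] at h
  · rintro ⟨μ, h⟩
    refine ⟨μ, initial_subst (fun y ν h => ?_) t μ h⟩
    by_cases hy : y = x
    · subst hy
      obtain ⟨w', h⟩ := h
      rw [mark_self]
      exact ⟨_, .plusL h⟩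
    · rwa [mark_of_ne _ _ hy]

/-- A transition of `p` would have to be labelled `β`, and would then yield a `β`-trace of length D
+ 1 in a term bisimilar to β^D. This weak form of cancellation suffices. -/
theorem par_pow_bisim_cancel_zero {β : Vis} {D : ℕ} {p q : Tm}
    (h : Bisim R (.par (pow (.vis β) D) p) (.par (pow (.vis β) D) q))
    (hq : Bisim R q .zero) : Bisim R p .zero := by
  have h := h.trans (par_bisim_left hq)
  rw [bisim_zero_iff]
  intro μ w hm
  obtain ⟨rfl, -⟩ := moveTo_pow.1 ((hm.parR _).left h)
  have ht : HasTrace R β 1 p := ⟨w, hm, trivial⟩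
  have := hasTrace_pow.1 (((hasTrace_pow.2 le_rfl).par ht).congr h)
  omega

/-- Sound equations preserve exposed variables, up to whether the parallel component is
bisimilar to `0`. -/
theorem Exposed.transfer (hI : Interleaves R α) {t u : Tm} (hs : Sound R t u) {x : ℕ} {r : Tm}
    (h : Exposed x t r) {σ : ℕ → Tm} {w : Tm} (hx : MoveTo R (.vis α) (σ x) w) :
    ∃ r', Exposed x u r' ∧ (Bisim R (r'.subst σ) .zero ↔ Bisim R (r.subst σ) .zero) := by
  have hR := hI.toAdmissible
  -- With this `D` the trace ᾱ^D is too long to come from anything but the added summand.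
  obtain ⟨D, hD⟩ : ∃ D, D = (u.subst σ).size + 1 := ⟨_, rfl⟩
  have hm : MoveTo R (.vis α) (mark α D x σ x) (pow (.vis α.bar) D) := by
    rw [mark_self]
    exact moveTo_plus.2 (.inr (Step.pre _ _).moveTo)
  have hm := (h.moveTo hI hm).left (hs.bisim_subst _)
  rcases moveTo_mark hR u hm with ⟨r', h', hb⟩ | hle
  · refine ⟨r', h', ?_⟩
    rw [← subst_mark_bisim_zero (D := D) hx, ← subst_mark_bisim_zero (D := D) hx]
    exact ⟨par_pow_bisim_cancel_zero hb, par_pow_bisim_cancel_zero hb.symm⟩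
  · have := hle (D + 0) ((hasTrace_pow.2 le_rfl).par trivial)
    omega

/-! ### The terms of the equation -/

/-- The action `α` followed by termination. -/
abbrev one (α : Vis) : Tm := .pre (.vis α) .zero

/-- The sum `ᾱ + ⋯ + ᾱⁱ`. -/
abbrev down (α : Vis) (i : ℕ) : Tm := powLe (.vis α.bar) i

theorem vis_bar_ne (α : Vis) : Act.vis α.bar ≠ .vis α := by
  intro h
  injection h with h
  exact α.bar_ne h

theorem moveTo_down {μ : Act} {i : ℕ} {w : Tm} :
    MoveTo R μ (down α i) w ↔ μ = .vis α.bar ∧ ∃ j < i, Bisim R w (pow (.vis α.bar) j) := by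
  simp only [down, powLe, moveTo_sum, List.mem_map, List.mem_range, ↓existsAndEq, and_true]
  constructor
  · rintro ⟨j, hj, hm⟩
    obtain ⟨rfl, j', hj', hb⟩ := moveTo_pow.1 hm
    obtain rfl : j = j' := by omega
    exact ⟨rfl, j, hj, hb⟩
  · rintro ⟨rfl, j, hj, hb⟩
    exact ⟨j, hj, moveTo_pow.2 ⟨rfl, j, rfl, hb⟩⟩

theorem hasTrace_down {k i : ℕ} : HasTrace R α.bar k (down α i) ↔ k ≤ i := by
  cases k with
  | zero => simp [HasTrace]
  | succ k =>
    constructor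
    · rintro ⟨w, hm, ht⟩
      obtain ⟨-, j, hj, hb⟩ := moveTo_down.1 hm
      have := hasTrace_pow.1 (ht.congr hb)
      omega
    · intro h
      exact ⟨_, moveTo_down.2 ⟨rfl, k, h, .refl _⟩, hasTrace_pow.2 le_rfl⟩

theorem down_injective {i j : ℕ} (h : Bisim R (down α i) (down α j)) : i = j :=
  le_antisymm (hasTrace_down.1 ((hasTrace_down.2 le_rfl).congr h))
    (hasTrace_down.1 ((hasTrace_down.2 le_rfl).congr h.symm))

theorem down_zero_bisim : Bisim R (down α 0) .zero := .refl _

theorem not_moveTo_down {i : ℕ} {w : Tm} : ¬ MoveTo R (.vis α) (down α i) w :=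
  fun h => vis_bar_ne α (moveTo_down.1 h).1.symm

theorem moveTo_qn {μ : Act} {n : ℕ} {w : Tm} :
    MoveTo R μ (qn α n) w ↔ μ = .vis α ∧ ∃ i ≤ n, Bisim R w (down α i) := by
  simp only [qn, moveTo_sum, List.mem_map, List.mem_range, ↓existsAndEq, and_true, moveTo_pre]
  constructor
  · rintro ⟨i, hi, rfl, hb⟩
    exact ⟨rfl, i, by omega, hb.symm⟩
  · rintro ⟨rfl, i, hi, hb⟩
    exact ⟨i, by omega, rfl, hb.symm⟩

theorem moveTo_one_par_qn {μ : Act} {n : ℕ} {w : Tm} :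
    MoveTo R μ (.par (one α) (qn α n)) w ↔
      μ = .vis α ∧ (Bisim R w (qn α n) ∨ ∃ i ≤ n, Bisim R w (.par (one α) (down α i))) := by
  constructor
  · rintro ⟨w', hs, hb⟩
    cases hs with
    | parL h =>
      obtain ⟨rfl, hb'⟩ := moveTo_pre.1 h.moveTo
      exact ⟨rfl, .inl (hb.symm.trans (par_bisim_right hb'.symm))⟩
    | parR h =>
      obtain ⟨rfl, i, hi, hb'⟩ := moveTo_qn.1 h.moveTo
      exact ⟨rfl, .inr ⟨i, hi, hb.symm.trans ((Bisim.refl _).par hb')⟩⟩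
    | @sync _ _ _ _ β h h' =>
      have h1 := (moveTo_pre.1 h.moveTo).1
      have h2 := (moveTo_qn.1 h'.moveTo).1
      injection h1 with h1
      subst h1
      exact (vis_bar_ne _ h2).elim
  · rintro ⟨rfl, hb | ⟨i, hi, hb⟩⟩
    · exact ((Step.pre _ _).moveTo.parL _).right ((zero_par_bisim _).trans hb.symm)
    · exact ((moveTo_qn.2 ⟨rfl, i, hi, .refl _⟩).parR _).right hb.symm

theorem moveTo_epsLhs (hI : Interleaves R α) {μ : Act} {n : ℕ} {w : Tm} :
    MoveTo R μ (epsLhs α n) w ↔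
      μ = .vis α ∧ (Bisim R w (qn α n) ∨ ∃ i ≤ n, Bisim R w (.par (one α) (down α i))) := by
  constructor
  · exact fun h => moveTo_one_par_qn.1 (hI.toAdmissible.moveTo_par h)
  · rintro ⟨rfl, h⟩
    exact hI.moveTo_op_iff.2 (moveTo_one_par_qn.2 ⟨rfl, h⟩)

theorem moveTo_epsRhs {μ : Act} {n : ℕ} {w : Tm} :
    MoveTo R μ (epsRhs α n) w ↔
      μ = .vis α ∧ (Bisim R w (qn α n) ∨ ∃ i ≤ n, Bisim R w (.par (one α) (down α i))) := by
  simp only [epsRhs, moveTo_plus, moveTo_pre, moveTo_sum, List.mem_map, List.mem_range,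
    ↓existsAndEq, and_true]
  constructor
  · rintro (⟨rfl, hb⟩ | ⟨i, hi, rfl, hb⟩)
    · exact ⟨rfl, .inl hb.symm⟩
    · exact ⟨rfl, .inr ⟨i, by omega, hb.symm⟩⟩
  · rintro ⟨rfl, hb | ⟨i, hi, hb⟩⟩
    · exact .inl ⟨rfl, hb.symm⟩
    · exact .inr ⟨i, by omega, rfl, hb.symm⟩

theorem epsLhs_bisim_epsRhs (hI : Interleaves R α) (n : ℕ) :
    Bisim R (epsLhs α n) (epsRhs α n) :=
  bisim_of_moveTo fun _ _ => (moveTo_epsLhs hI).trans moveTo_epsRhs.symm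

/-! ### Closedness of both sides of `ε_n` -/

theorem closed_pre {μ : Act} {p : Tm} (h : p.Closed) : (Tm.pre μ p).Closed := h

theorem closed_plus {p q : Tm} (hp : p.Closed) (hq : q.Closed) : (Tm.plus p q).Closed :=
  fun x => by simp [Tm.occ, hp x, hq x]

theorem closed_par {p q : Tm} (hp : p.Closed) (hq : q.Closed) : (Tm.par p q).Closed :=
  fun x => by simp [Tm.occ, hp x, hq x]

theorem closed_op {p q : Tm} (hp : p.Closed) (hq : q.Closed) : (Tm.op p q).Closed :=
  fun x => by simp [Tm.occ, hp x, hq x]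

theorem closed_zero : Tm.zero.Closed := fun _ => rfl

theorem closed_sum {l : List Tm} (h : ∀ t ∈ l, t.Closed) : (Tm.sum l).Closed := by
  induction l with
  | nil => exact closed_zero
  | cons t l ih =>
    cases l with
    | nil => exact h t (by simp)
    | cons u l =>
      exact closed_plus (h t (by simp)) (ih fun s hs => h s (List.mem_cons_of_mem _ hs))

theorem closed_pow (μ : Act) (m : ℕ) : (pow μ m).Closed := by
  induction m with
  | zero => exact closed_zero
  | succ m ih => exact closed_pre ih

theorem closed_powLe (μ : Act) (i : ℕ) : (powLe μ i).Closed :=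
  closed_sum (by simp [closed_pow])

theorem closed_qn (α : Vis) (n : ℕ) : (qn α n).Closed :=
  closed_sum (by
    simp only [List.mem_map, forall_exists_index, and_imp, forall_apply_eq_imp_iff₂]
    exact fun i _ => closed_pre (closed_powLe _ _))

theorem closed_epsLhs (α : Vis) (n : ℕ) : (epsLhs α n).Closed :=
  closed_op (closed_pre closed_zero) (closed_qn α n)

theorem closed_epsRhs (α : Vis) (n : ℕ) : (epsRhs α n).Closed :=
  closed_plus (closed_pre (closed_qn α n)) (closed_sum (by
    simp only [List.mem_map, forall_exists_index, and_imp, forall_apply_eq_imp_iff₂]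
    exact fun i _ => closed_pre (closed_par (closed_pre closed_zero) (closed_powLe _ _))))

/-! ### Parallel decompositions -/

theorem exists_moveTo {p : Tm} (h : ¬ Bisim R p .zero) : ∃ μ w, MoveTo R μ p w := by
  simpa [bisim_zero_iff] using h

theorem not_bisim_zero {μ : Act} {p w : Tm} (h : MoveTo R μ p w) : ¬ Bisim R p .zero :=
  fun hp => bisim_zero_iff.1 hp _ _ h

theorem not_one_bisim_zero : ¬ Bisim R (one α) .zero := not_bisim_zero (Step.pre _ _).moveTo

theorem not_qn_bisim_zero {n : ℕ} : ¬ Bisim R (qn α n) .zero :=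
  not_bisim_zero (moveTo_qn.2 ⟨rfl, 0, Nat.zero_le _, .refl _⟩)

/-- For i ≥ 1 the sum ᾱ + ⋯ + ᾱⁱ can reach `0` in one step. In a composition this step must leave
both components bisimilar to `0`, so it is made by `q`, and `p` is bisimilar to `0` from the start.
-/
theorem left_of_par_bisim_down {p q : Tm} {i : ℕ} (h : Bisim R (.par p q) (down α i))
    (hq : ¬ Bisim R q .zero) : Bisim R p .zero ∧ Bisim R q (down α i) := by
  suffices hp : Bisim R p .zero from ⟨hp, (par_bisim_right hp).symm.trans h⟩
  rcases Nat.eq_zero_or_pos i with rfl | hi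
  · exact (hq (par_bisim_zero.1 (h.trans down_zero_bisim)).2).elim
  · have hm : MoveTo R (.vis α.bar) (down α i) .zero := moveTo_down.2 ⟨rfl, 0, hi, .refl _⟩
    rcases moveTo_par_vis.1 (hm.left h.symm) with ⟨p', -, hb⟩ | ⟨q', -, hb⟩
    · exact (hq (par_bisim_zero.1 hb).2).elim
    · exact (par_bisim_zero.1 hb).1

theorem right_of_par_bisim_down {p q : Tm} {i : ℕ} (h : Bisim R (.par p q) (down α i))
    (hp : ¬ Bisim R p .zero) : Bisim R q .zero ∧ Bisim R p (down α i) :=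
  left_of_par_bisim_down ((par_comm_bisim _ _).trans h) hp

theorem moveTo_one_par_down {i : ℕ} {w : Tm} :
    MoveTo R (.vis α) (.par (one α) (down α i)) w ↔ Bisim R w (down α i) := by
  rw [moveTo_par_vis]
  constructor
  · rintro (⟨p', hm, hb⟩ | ⟨q', hm, -⟩)
    · exact hb.symm.trans (par_bisim_right (moveTo_pre.1 hm).2.symm)
    · exact (not_moveTo_down hm).elim
  · intro h
    exact .inl ⟨_, (Step.pre _ _).moveTo, (zero_par_bisim _).trans h.symm⟩

theorem hasTrace_one_par_down {i k : ℕ} (h : HasTrace R α.bar k (.par (one α) (down α i))) :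
    k ≤ i := by
  obtain ⟨a, b, rfl, ha, hb⟩ := h.of_par
  have := hasTrace_down.1 hb
  rcases hasTrace_pre ha with rfl | ⟨h, -⟩
  · omega
  · exact (vis_bar_ne α h.symm).elim

theorem par_bisim_one {p q : Tm} (h : Bisim R (.par p q) (one α)) (hq : ¬ Bisim R q .zero) :
    Bisim R p .zero ∧ Bisim R q (one α) := by
  suffices hp : Bisim R p .zero from ⟨hp, (par_bisim_right hp).symm.trans h⟩
  have hm : MoveTo R (.vis α) (one α) .zero := (Step.pre _ _).moveTo
  rcases moveTo_par_vis.1 (hm.left h.symm) with ⟨p', -, hb⟩ | ⟨q', -, hb⟩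
  · exact (hq (par_bisim_zero.1 hb).2).elim
  · exact (par_bisim_zero.1 hb).1

/-- `q_n` is not a parallel composition of two terms that are not bisimilar to `0`. -/
theorem par_bisim_qn {p q : Tm} {n : ℕ} (h : Bisim R (.par p q) (qn α n))
    (hq : ¬ Bisim R q .zero) : Bisim R p .zero := by
  by_contra hp
  obtain ⟨μ, p', hp⟩ := exists_moveTo hp
  obtain ⟨ν, q', hq⟩ := exists_moveTo hq
  obtain ⟨rfl, -⟩ := moveTo_qn.1 ((hp.parL q).left h)
  obtain ⟨rfl, -⟩ := moveTo_qn.1 ((hq.parR p).left h)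
  obtain ⟨-, i, -, hb⟩ := moveTo_qn.1 ((hp.parL q).left h)
  exact not_moveTo_down ((hq.parR p').left hb)

/-- The `α`-transitions of `p` are, modulo bisimilarity, among those of `q`. -/
def Below (R : Set Rule) (α : Vis) (p q : Tm) : Prop :=
  ∀ w, MoveTo R (.vis α) p w → MoveTo R (.vis α) q w

/-- `p` and `q` have the same `α`-transitions modulo bisimilarity. -/
def SameMoves (R : Set Rule) (α : Vis) (p q : Tm) : Prop :=
  ∀ w, MoveTo R (.vis α) p w ↔ MoveTo R (.vis α) q w

theorem Bisim.moveTo_iff {μ : Act} {p q w : Tm} (h : Bisim R p q) :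
    MoveTo R μ p w ↔ MoveTo R μ q w :=
  ⟨fun hm => hm.left h, fun hm => hm.left h.symm⟩

theorem Bisim.sameMoves {p q : Tm} (h : Bisim R p q) : SameMoves R α p q :=
  fun _ => h.moveTo_iff

theorem SameMoves.trans {p q r : Tm} (h : SameMoves R α p q) (h' : SameMoves R α q r) :
    SameMoves R α p r := fun w => (h w).trans (h' w)

theorem Interleaves.sameMoves (hI : Interleaves R α) (p q : Tm) :
    SameMoves R α (.op p q) (.par p q) := fun _ => hI.moveTo_op_iff

/-- Primality of q_n identifies `q`. To identify `p`, let `q` move to ᾱ + ⋯ + ᾱⁱ and see which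
derivatives of f(α, q_n) the results can be; i = 0 exhibits `p` itself. -/
theorem factors_of_left (hI : Interleaves R α) {n : ℕ} (hn : 1 ≤ n) {p q p' : Tm}
    (h : Below R α (.par p q) (epsLhs α n)) (hq : ¬ Bisim R q .zero)
    (hb : Bisim R (.par p' q) (qn α n)) :
    Bisim R p (one α) ∧ Bisim R q (qn α n) := by
  have hq' : Bisim R q (qn α n) := (par_bisim_right (par_bisim_qn hb hq)).symm.trans hb
  refine ⟨?_, hq'⟩
  have hmem : ∀ i ≤ n, Bisim R (.par p (down α i)) (qn α n) ∨
      ∃ j ≤ n, Bisim R (.par p (down α i)) (.par (one α) (down α j)) := fun i hi =>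
    ((moveTo_epsLhs hI).1
      (h _ (((moveTo_qn.2 ⟨rfl, i, hi, .refl _⟩).left hq'.symm).parR p))).2
  have hd : ∀ i, 1 ≤ i → MoveTo R (.vis α.bar) (.par p (down α i)) (.par p .zero) := fun i hi =>
    MoveTo.parR (moveTo_down.2 ⟨rfl, 0, hi, .refl _⟩) p
  have hnq : ∀ i, 1 ≤ i → ¬ Bisim R (.par p (down α i)) (qn α n) := fun i hi hb =>
    vis_bar_ne α (moveTo_qn.1 ((hd i hi).left hb)).1
  have hp0 : Bisim R (.par p (down α 0)) p := par_bisim_left down_zero_bisim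
  rcases hmem 0 (Nat.zero_le _) with hb0 | ⟨j, hj, hb0⟩
  · have hp := hp0.symm.trans hb0
    -- If `p` were bisimilar to q_n, then q_n ∥ ᾱ would be bisimilar to some α ∥ (ᾱ + ⋯ + ᾱᵏ), which
    -- has one `α`-derivative only; but q_n ∥ ᾱ has both `0` ∥ ᾱ and ᾱ ∥ ᾱ, with longest `ᾱ`-traces
    -- 1 and 2.
    rcases hmem 1 hn with hb1 | ⟨k, hk, hb1⟩
    · exact (hnq 1 le_rfl hb1).elim
    · have hdd : ∀ i ≤ n, Bisim R (.par (down α i) (down α 1)) (down α k) := fun i hi =>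
        moveTo_one_par_down.1
          ((((moveTo_qn.2 ⟨rfl, i, hi, .refl _⟩).left hp.symm).parL _).left hb1)
      have h2 : HasTrace R α.bar 2 (.par (down α 1) (down α 1)) :=
        HasTrace.par (i := 1) (j := 1) (hasTrace_down.2 le_rfl) (hasTrace_down.2 le_rfl)
      have := hasTrace_down.1 (((h2.congr (hdd 1 hn)).congr (hdd 0 (Nat.zero_le _)).symm).congr
        (par_bisim_right down_zero_bisim))
      omega
  · have hp := hp0.symm.trans hb0
    -- Here `p` contributes `ᾱ`-traces of length j; next to ᾱ + ⋯ + ᾱⁿ these add up to j + n, while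
    -- no derivative allows more than n. So j = 0.
    rcases hmem n le_rfl with hb1 | ⟨k, hk, hb1⟩
    · exact (hnq n hn hb1).elim
    · have ht : HasTrace R α.bar (0 + j + n) (.par (.par (one α) (down α j)) (down α n)) :=
        (HasTrace.par (i := 0) (p := one α) trivial (hasTrace_down.2 le_rfl)).par (hasTrace_down.2 le_rfl)
      have := hasTrace_one_par_down ((ht.congr (hp.symm.par (.refl _))).congr hb1)
      obtain rfl : j = 0 := by omega
      exact hp.trans (par_bisim_left down_zero_bisim)

theorem factors_of_sameMoves (hI : Interleaves R α) {n : ℕ} (hn : 1 ≤ n) {p q : Tm}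
    (h : SameMoves R α (.par p q) (epsLhs α n)) (hp : ¬ Bisim R p .zero)
    (hq : ¬ Bisim R q .zero) :
    Bisim R p (one α) ∧ Bisim R q (qn α n) ∨ Bisim R q (one α) ∧ Bisim R p (qn α n) := by
  have hm := (h _).2 ((moveTo_epsLhs hI).2 ⟨rfl, .inl (.refl _)⟩)
  rcases moveTo_par_vis.1 hm with ⟨p', -, hb⟩ | ⟨q', -, hb⟩
  · exact .inl (factors_of_left hI hn (fun w => (h w).1) hq hb)
  · refine .inr (factors_of_left hI hn (fun w hw => (h w).1 ?_) hp
      ((par_comm_bisim _ _).trans hb))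
    exact hw.left (par_comm_bisim _ _)

/-! ### Counting `α`-transitions to the sums ᾱ + ⋯ + ᾱⁱ -/

/-- `p` has `α`-transitions to two different sums `ᾱ + ⋯ + ᾱⁱ`, modulo bisimilarity. -/
def TwoDown (R : Set Rule) (α : Vis) (p : Tm) : Prop :=
  ∃ i j, i < j ∧ MoveTo R (.vis α) p (down α i) ∧ MoveTo R (.vis α) p (down α j)

open Classical in
/-- The numbers `i ≤ n` such that `p` has an `α`-transition to `ᾱ + ⋯ + ᾱⁱ`. -/
noncomputable def downs (R : Set Rule) (α : Vis) (n : ℕ) (p : Tm) : Finset ℕ :=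
  (Finset.range (n + 1)).filter fun i => MoveTo R (.vis α) p (down α i)

theorem mem_downs {n i : ℕ} {p : Tm} :
    i ∈ downs R α n p ↔ i < n + 1 ∧ MoveTo R (.vis α) p (down α i) := by
  simp [downs]

theorem downs_congr {n : ℕ} {p q : Tm} (h : SameMoves R α p q) :
    downs R α n p = downs R α n q := by
  ext i
  rw [mem_downs, mem_downs, h]

/-- The component that does not move must be the whole sum, which determines the index. If the two
transitions came from different sides, a component would be such a sum and yet perform `α`. -/
theorem eq_of_moveTo_par_down {p q : Tm} (hp : ¬ Bisim R p .zero) (hq : ¬ Bisim R q .zero) {i j : ℕ}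
    (hi : MoveTo R (.vis α) (.par p q) (down α i))
    (hj : MoveTo R (.vis α) (.par p q) (down α j)) : i = j := by
  rcases moveTo_par_vis.1 hi with ⟨p', hpm, hb⟩ | ⟨q', hqm, hb⟩ <;>
    rcases moveTo_par_vis.1 hj with ⟨p'', hpm', hb'⟩ | ⟨q'', hqm', hb'⟩
  · exact down_injective ((left_of_par_bisim_down hb hq).2.symm.trans
      (left_of_par_bisim_down hb' hq).2)
  · exact (not_moveTo_down (hpm.left (right_of_par_bisim_down hb' hp).2)).elim
  · exact (not_moveTo_down (hqm.left (left_of_par_bisim_down hb' hq).2)).elim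
  · exact down_injective ((right_of_par_bisim_down hb hp).2.symm.trans
      (right_of_par_bisim_down hb' hp).2)

theorem card_downs_le_one {n : ℕ} {p : Tm}
    (h : ∀ i j, MoveTo R (.vis α) p (down α i) → MoveTo R (.vis α) p (down α j) → i = j) :
    (downs R α n p).card ≤ 1 :=
  Finset.card_le_one.2 fun i hi j hj => h i j (mem_downs.1 hi).2 (mem_downs.1 hj).2

theorem Exposed.op_of_par {x : ℕ} {t u r : Tm} (h : Exposed x (.par t u) r) :
    Exposed x (.op t u) r := by
  cases h with
  | parL _ h => exact .opL u h
  | parR _ h => exact .opR t h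

/-- A term with few operator symbols can only have many transitions to different sums
`ᾱ + ⋯ + ᾱⁱ` if one of its exposed variables has two of them. -/
theorem exposed_or_card_downs_le (hI : Interleaves R α) (n : ℕ) (σ : ℕ → Tm) (t : Tm) :
    (∃ x r, Exposed x t r ∧ Bisim R (r.subst σ) .zero ∧ TwoDown R α (σ x)) ∨
      (downs R α n (t.subst σ)).card ≤ t.size + 1 := by
  have hpar : ∀ t u : Tm,
      ((∃ x r, Exposed x t r ∧ Bisim R (r.subst σ) .zero ∧ TwoDown R α (σ x)) ∨
        (downs R α n (t.subst σ)).card ≤ t.size + 1) →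
      ((∃ x r, Exposed x u r ∧ Bisim R (r.subst σ) .zero ∧ TwoDown R α (σ x)) ∨
        (downs R α n (u.subst σ)).card ≤ u.size + 1) →
      (∃ x r, Exposed x (.par t u) r ∧ Bisim R (r.subst σ) .zero ∧ TwoDown R α (σ x)) ∨
        (downs R α n (.par (t.subst σ) (u.subst σ))).card ≤ t.size + u.size + 1 + 1 := by
    intro t u ih1 ih2
    by_cases hu : Bisim R (u.subst σ) .zero
    · rcases ih1 with ⟨x, r, h, hr, hx⟩ | h
      · exact .inl ⟨x, _, .parL u h, par_bisim_zero.2 ⟨hr, hu⟩, hx⟩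
      · rw [downs_congr (par_bisim_left hu).sameMoves]
        exact .inr (by omega)
    by_cases ht : Bisim R (t.subst σ) .zero
    · rcases ih2 with ⟨x, r, h, hr, hx⟩ | h
      · exact .inl ⟨x, _, .parR t h, par_bisim_zero.2 ⟨hr, ht⟩, hx⟩
      · rw [downs_congr (par_bisim_right ht).sameMoves]
        exact .inr (by omega)
    exact .inr ((card_downs_le_one fun i j hi hj => eq_of_moveTo_par_down ht hu hi hj).trans
      (by omega))
  induction t with
  | zero =>
    exact .inr ((card_downs_le_one fun i j h => (not_moveTo_zero h).elim).trans (by simp))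
  | var x =>
    by_cases h : TwoDown R α (σ x)
    · exact .inl ⟨x, _, .var, .refl _, h⟩
    · refine .inr (card_downs_le_one fun i j hi hj => ?_)
      by_contra hij
      rcases Nat.lt_or_gt_of_ne hij with hij | hij
      · exact h ⟨i, j, hij, hi, hj⟩
      · exact h ⟨j, i, hij, hj, hi⟩
  | pre μ t _ =>
    refine .inr ((card_downs_le_one fun i j hi hj => ?_).trans (by simp))
    exact down_injective ((moveTo_pre.1 hi).2.symm.trans (moveTo_pre.1 hj).2)
  | plus t u ih1 ih2 =>
    rcases ih1 with ⟨x, r, h, hr⟩ | h1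
    · exact .inl ⟨x, r, .plusL u h, hr⟩
    rcases ih2 with ⟨x, r, h, hr⟩ | h2
    · exact .inl ⟨x, r, .plusR t h, hr⟩
    right
    have hsub : downs R α n ((Tm.plus t u).subst σ) ⊆
        downs R α n (t.subst σ) ∪ downs R α n (u.subst σ) := fun i hi => by
      rw [Finset.mem_union, mem_downs, mem_downs, ← and_or_left, ← moveTo_plus]
      exact mem_downs.1 hi
    have := (Finset.card_le_card hsub).trans (Finset.card_union_le _ _)
    -- The operator + itself counts 1, which is exactly what adding the two bounds size + 1
    -- requires.
    simp only [Tm.size]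
    omega
  | par t u ih1 ih2 => exact hpar t u ih1 ih2
  | op t u ih1 ih2 =>
    simp only [Tm.subst, Tm.size, downs_congr (hI.sameMoves _ _)]
    refine (hpar t u ih1 ih2).imp_left ?_
    rintro ⟨x, r, h, hr⟩
    exact ⟨x, r, h.op_of_par, hr⟩

/-- A term with fewer than `n` operator symbols can only be instantiated to `q_n` if it has an
exposed variable with two of the summands. -/
theorem exposed_of_bisim_qn (hI : Interleaves R α) {n : ℕ} {σ : ℕ → Tm} {t : Tm}
    (ht : t.size < n) (h : Bisim R (t.subst σ) (qn α n)) :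
    ∃ x r, Exposed x t r ∧ Bisim R (r.subst σ) .zero ∧ TwoDown R α (σ x) := by
  refine (exposed_or_card_downs_le hI n σ t).resolve_right fun hle => ?_
  -- All n + 1 indices occur, against a bound of at most n.
  have hall : downs R α n (t.subst σ) = Finset.range (n + 1) := by
    ext i
    rw [mem_downs, Finset.mem_range, and_iff_left_iff_imp]
    exact fun hi => (moveTo_qn.2 ⟨rfl, i, by omega, .refl _⟩).left h.symm
  rw [hall, Finset.card_range] at hle
  omega

/-! ### The invariant -/

/-- Up to components bisimilar to `0`, the term has a summand with the `α`-transitions of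
`f(α, q_n)` that is not a parallel composition with a component bisimilar to `0`. -/
def Good (R : Set Rule) (α : Vis) (n : ℕ) : Tm → Prop
  | .zero => False
  | .var _ => False
  | .pre μ p => SameMoves R α (.pre μ p) (epsLhs α n)
  | .plus p q => Good R α n p ∨ Good R α n q
  | .par p q => (¬ Bisim R p .zero ∧ ¬ Bisim R q .zero ∧ SameMoves R α (.par p q) (epsLhs α n)) ∨
      (Bisim R q .zero ∧ Good R α n p) ∨ (Bisim R p .zero ∧ Good R α n q)
  | .op p q => (¬ Bisim R p .zero ∧ ¬ Bisim R q .zero ∧ SameMoves R α (.op p q) (epsLhs α n)) ∨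
      (Bisim R q .zero ∧ Good R α n p) ∨ (Bisim R p .zero ∧ Good R α n q)

/-- A prefix has a single derivative, but for n ≥ 1 the derivatives α ∥ `0` and α ∥ ᾱ of f(α, q_n)
differ. -/
theorem not_good_pre (hI : Interleaves R α) {n : ℕ} (hn : 1 ≤ n) {μ : Act} {p : Tm} :
    ¬ Good R α n (.pre μ p) := by
  intro h
  have hd : ∀ i ≤ n, Bisim R p (.par (one α) (down α i)) := fun i hi =>
    (moveTo_pre.1 ((h _).2 ((moveTo_epsLhs hI).2 ⟨rfl, .inr ⟨i, hi, .refl _⟩⟩))).2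
  have := moveTo_one_par_down.1
    ((moveTo_one_par_down.2 (.refl _)).left ((hd 0 (Nat.zero_le _)).symm.trans (hd 1 hn)))
  exact Nat.zero_ne_one (down_injective this)

/-- This is the reason for `SameMoves` instead of `Bisim` in `Good`: f and ∥ need not agree on other
actions. -/
theorem good_op_iff (hI : Interleaves R α) {n : ℕ} {p q : Tm} :
    Good R α n (.op p q) ↔ Good R α n (.par p q) := by
  simp only [Good, SameMoves, hI.moveTo_op_iff]

theorem Good.below (hI : Interleaves R α) {n : ℕ} {p : Tm} (h : Good R α n p) :
    Below R α (epsLhs α n) p := by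
  have hpar : ∀ p q, (Good R α n p → Below R α (epsLhs α n) p) →
      (Good R α n q → Below R α (epsLhs α n) q) → Good R α n (.par p q) →
      Below R α (epsLhs α n) (.par p q) := by
    rintro p q ih1 ih2 (⟨-, -, h⟩ | ⟨h0, h⟩ | ⟨h0, h⟩) w hw
    · exact (h w).2 hw
    · exact (ih1 h w hw).left (par_bisim_left h0).symm
    · exact (ih2 h w hw).left (par_bisim_right h0).symm
  induction p with
  | zero => exact h.elim
  | var x => exact h.elim
  | pre μ p _ => exact fun w => (h w).2
  | plus p q ih1 ih2 =>
    intro w hw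
    exact moveTo_plus.2 (h.imp (fun h => ih1 h w hw) fun h => ih2 h w hw)
  | par p q ih1 ih2 => exact hpar p q ih1 ih2 h
  | op p q ih1 ih2 =>
    exact fun w hw => hI.moveTo_op_iff.2 (hpar p q ih1 ih2 ((good_op_iff hI).1 h) w hw)

theorem Exposed.good_of_bisim_zero {n x : ℕ} {t r : Tm} {σ : ℕ → Tm}
    (h : Exposed x t r) (hx : Good R α n (σ x)) (hr : Bisim R (r.subst σ) .zero) :
    Good R α n (t.subst σ) := by
  induction h with
  | var => exact hx
  | plusL u _ ih => exact .inl (ih hr)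
  | plusR t _ ih => exact .inr (ih hr)
  | parL u _ ih | opL u _ ih =>
    exact .inr (.inl ⟨(par_bisim_zero.1 hr).2, ih (par_bisim_zero.1 hr).1⟩)
  | parR t _ ih | opR t _ ih =>
    exact .inr (.inr ⟨(par_bisim_zero.1 hr).2, ih (par_bisim_zero.1 hr).1⟩)

/-- Having an initial `ᾱ`, the derivative must be some α ∥ (ᾱ + ⋯ + ᾱᵏ) with k ≥ 1, which can reach
α by one `ᾱ`. To match this step, the sum on the left has to move, because otherwise an `ᾱ` remains
possible. The action `α` is then left to `p`, and α is prime. -/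
theorem bisim_one_of_par_down {n j : ℕ} (hI : Interleaves R α) {p : Tm} (hj : 1 ≤ j)
    (h : MoveTo R (.vis α) (epsLhs α n) (.par (down α j) p)) : Bisim R p (one α) := by
  have hm : MoveTo R (.vis α.bar) (.par (down α j) p) (.par .zero p) :=
    MoveTo.parL (moveTo_down.2 ⟨rfl, 0, hj, .refl _⟩) p
  rcases ((moveTo_epsLhs hI).1 h).2 with hb | ⟨k, -, hb⟩
  · exact (vis_bar_ne α (moveTo_qn.1 (hm.left hb)).1).elim
  · obtain ⟨k, rfl⟩ : ∃ k', k = k' + 1 := by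
      rcases Nat.eq_zero_or_pos k with rfl | hk
      · have := hasTrace_one_par_down (k := 1) (HasTrace.congr ⟨_, hm, trivial⟩ hb)
        omega
      · exact ⟨k - 1, by omega⟩
    have hm' : MoveTo R (.vis α.bar) (.par (one α) (down α (k + 1))) (.par (one α) .zero) :=
      MoveTo.parR (moveTo_down.2 ⟨rfl, 0, by omega, .refl _⟩) _
    rcases moveTo_par_vis.1 ((hm'.left hb.symm).right (par_zero_bisim _)) with
      ⟨w, hw, hb'⟩ | ⟨w, hw, hb'⟩
    · obtain ⟨-, m, -, hwm⟩ := moveTo_down.1 hw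
      have hα : MoveTo R (.vis α) (.par w p) .zero := (Step.pre _ _).moveTo.left hb'.symm
      rcases moveTo_par_vis.1 hα with ⟨w', hw', -⟩ | ⟨p', hp, -⟩
      · exact (vis_bar_ne α (moveTo_pow.1 (hw'.left hwm)).1.symm).elim
      · exact (par_bisim_one hb' (not_bisim_zero hp)).2
    · exact (vis_bar_ne α (moveTo_pre.1
        (MoveTo.left (MoveTo.parL (moveTo_down.2 ⟨rfl, 0, hj, .refl _⟩) w) hb')).1).elim

theorem Below.left_of_par {p q r : Tm} (h : Below R α (.par p q) r) (hq : Bisim R q .zero) :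
    Below R α p r := fun w hw => h w (hw.left (par_bisim_left hq).symm)

theorem Below.right_of_par {p q r : Tm} (h : Below R α (.par p q) r) (hp : Bisim R p .zero) :
    Below R α q r := fun w hw => h w (hw.left (par_bisim_right hp).symm)

theorem sameMoves_one_par_qn (hI : Interleaves R α) (n : ℕ) :
    SameMoves R α (.par (one α) (qn α n)) (epsLhs α n) := fun _ => hI.moveTo_op_iff.symm

/-- The larger index j is at least 1, so `bisim_one_of_par_down` makes `r` ∥ `p` bisimilar to α,
whence `r` vanishes and `p` is α. After the `α` of `p` the instance of `t` remains; it has two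
different `α`-derivatives and is therefore not some α ∥ (ᾱ + ⋯ + ᾱᵏ), so it is q_n. -/
theorem sameMoves_of_exposed (hI : Interleaves R α) {n x : ℕ} {t r p : Tm} {σ : ℕ → Tm}
    (h : Exposed x t r) (hx : TwoDown R α (σ x)) (hp : ¬ Bisim R p .zero)
    (hb : Below R α (.par (t.subst σ) p) (epsLhs α n)) :
    ¬ Bisim R (t.subst σ) .zero ∧ SameMoves R α (.par (t.subst σ) p) (epsLhs α n) := by
  obtain ⟨i, j, hij, hi, hj⟩ := hx
  have hmi := h.moveTo hI hi
  have hmj := h.moveTo hI hj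
  have h1 : Bisim R (.par (r.subst σ) p) (one α) :=
    bisim_one_of_par_down hI (by omega)
      (hb _ ((hmj.parL p).right (par_assoc_bisim _ _ _)))
  obtain ⟨hr, hp1⟩ := par_bisim_one h1 hp
  refine ⟨not_bisim_zero hmi, ?_⟩
  have hmi := hmi.right (par_bisim_left hr)
  have hmj := hmj.right (par_bisim_left hr)
  have hm : MoveTo R (.vis α) (.par (t.subst σ) p) (t.subst σ) :=
    (((Step.pre _ _).moveTo.left hp1.symm).parR _).right (par_zero_bisim _)
  rcases ((moveTo_epsLhs hI).1 (hb _ hm)).2 with hq | ⟨k, -, hk⟩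
  · exact ((hq.par hp1).trans (par_comm_bisim _ _)).sameMoves.trans (sameMoves_one_par_qn hI n)
  · have h1 := moveTo_one_par_down.1 (hmi.left hk)
    have h2 := moveTo_one_par_down.1 (hmj.left hk)
    exact (hij.ne (down_injective (h1.trans h2.symm))).elim

/-- On the way down to the occurrence of `x`, siblings bisimilar to `0` are skipped. The first other
sibling exists because `r` is not bisimilar to `0`, and there `sameMoves_of_exposed` applies. -/
theorem Exposed.good_of_twoDown (hI : Interleaves R α) {n x : ℕ} {t r : Tm} {σ : ℕ → Tm}
    (h : Exposed x t r) (hx : TwoDown R α (σ x)) (hr : ¬ Bisim R (r.subst σ) .zero)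
    (hb : Below R α (t.subst σ) (epsLhs α n)) : Good R α n (t.subst σ) := by
  have hpar : ∀ {t u r : Tm}, Exposed x t r →
      (¬ Bisim R (r.subst σ) .zero → Below R α (t.subst σ) (epsLhs α n) →
        Good R α n (t.subst σ)) →
      ¬ Bisim R (.par (r.subst σ) (u.subst σ)) .zero →
      Below R α (.par (t.subst σ) (u.subst σ)) (epsLhs α n) →
      Good R α n (.par (t.subst σ) (u.subst σ)) := by
    intro t u r h ih hr hb
    by_cases hu : Bisim R (u.subst σ) .zero
    · exact .inr (.inl ⟨hu, ih (fun hr' => hr (par_bisim_zero.2 ⟨hr', hu⟩)) (hb.left_of_par hu)⟩)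
    · obtain ⟨ht, hs⟩ := sameMoves_of_exposed hI h hx hu hb
      exact .inl ⟨ht, hu, hs⟩
  have hcomm : ∀ {p q : Tm}, Good R α n (.par p q) → Good R α n (.par q p) := by
    rintro p q (⟨h1, h2, h3⟩ | h | h)
    · exact .inl ⟨h2, h1, (par_comm_bisim _ _).sameMoves.trans h3⟩
    · exact .inr (.inr h)
    · exact .inr (.inl h)
  induction h with
  | var => exact (hr (.refl _)).elim
  | plusL u _ ih => exact .inl (ih hr fun w hw => hb w (moveTo_plus.2 (.inl hw)))
  | plusR t _ ih => exact .inr (ih hr fun w hw => hb w (moveTo_plus.2 (.inr hw)))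
  | parL u h ih => exact hpar h ih hr hb
  | parR t h ih =>
    exact hcomm (hpar h ih hr fun w hw => hb w (hw.left (par_comm_bisim _ _)))
  | opL u h ih =>
    exact (good_op_iff hI).2 (hpar h ih hr fun w hw => hb w (hI.moveTo_op_iff.2 hw))
  | opR t h ih =>
    exact (good_op_iff hI).2 (hcomm (hpar h ih hr fun w hw =>
      hb w (hI.moveTo_op_iff.2 (hw.left (par_comm_bisim _ _)))))

/-- The reason why an instance of a small term is good. -/
theorem Good.exposed (hI : Interleaves R α) {n : ℕ} {σ : ℕ → Tm} {t : Tm} (ht : t.size < n)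
    (h : Good R α n (t.subst σ)) :
    (∃ x r, Exposed x t r ∧ Bisim R (r.subst σ) .zero ∧ Good R α n (σ x)) ∨
      ∃ x r, Exposed x t r ∧ ¬ Bisim R (r.subst σ) .zero ∧ TwoDown R α (σ x) := by
  have hpar : ∀ t u : Tm, t.size + u.size + 1 < n →
      (t.size < n → Good R α n (t.subst σ) →
        (∃ x r, Exposed x t r ∧ Bisim R (r.subst σ) .zero ∧ Good R α n (σ x)) ∨
          ∃ x r, Exposed x t r ∧ ¬ Bisim R (r.subst σ) .zero ∧ TwoDown R α (σ x)) →
      (u.size < n → Good R α n (u.subst σ) →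
        (∃ x r, Exposed x u r ∧ Bisim R (r.subst σ) .zero ∧ Good R α n (σ x)) ∨
          ∃ x r, Exposed x u r ∧ ¬ Bisim R (r.subst σ) .zero ∧ TwoDown R α (σ x)) →
      Good R α n (.par (t.subst σ) (u.subst σ)) →
      (∃ x r, Exposed x (.par t u) r ∧ Bisim R (r.subst σ) .zero ∧ Good R α n (σ x)) ∨
        ∃ x r, Exposed x (.par t u) r ∧ ¬ Bisim R (r.subst σ) .zero ∧ TwoDown R α (σ x) := by
    rintro t u hn ih1 ih2 (⟨h1, h2, h⟩ | ⟨h0, h⟩ | ⟨h0, h⟩)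
    · right
      -- One of the factors is q_n. It is an instance of a term smaller than n, so an exposed
      -- variable supplies two derivatives, and the other factor runs in parallel with it.
      rcases factors_of_sameMoves hI (by omega) h h1 h2 with ⟨-, hq⟩ | ⟨-, hq⟩
      · obtain ⟨x, r, h, -, hx⟩ := exposed_of_bisim_qn hI (by omega) hq
        exact ⟨x, _, .parR t h, fun h0 => h1 (par_bisim_zero.1 h0).2, hx⟩
      · obtain ⟨x, r, h, -, hx⟩ := exposed_of_bisim_qn hI (by omega) hq
        exact ⟨x, _, .parL u h, fun h0 => h2 (par_bisim_zero.1 h0).2, hx⟩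
    · rcases ih1 (by omega) h with ⟨x, r, h, hr, hx⟩ | ⟨x, r, h, hr, hx⟩
      · exact .inl ⟨x, _, .parL u h, par_bisim_zero.2 ⟨hr, h0⟩, hx⟩
      · exact .inr ⟨x, _, .parL u h, fun h0 => hr (par_bisim_zero.1 h0).1, hx⟩
    · rcases ih2 (by omega) h with ⟨x, r, h, hr, hx⟩ | ⟨x, r, h, hr, hx⟩
      · exact .inl ⟨x, _, .parR t h, par_bisim_zero.2 ⟨hr, h0⟩, hx⟩
      · exact .inr ⟨x, _, .parR t h, fun h0 => hr (par_bisim_zero.1 h0).1, hx⟩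
  induction t with
  | zero => exact h.elim
  | var x => exact .inl ⟨x, _, .var, .refl _, h⟩
  | pre μ t _ => exact (not_good_pre hI (by omega) h).elim
  | plus t u ih1 ih2 =>
    simp only [Tm.size] at ht
    rcases h with h | h
    · rcases ih1 (by omega) h with ⟨x, r, h, hr⟩ | ⟨x, r, h, hr⟩
      · exact .inl ⟨x, r, .plusL u h, hr⟩
      · exact .inr ⟨x, r, .plusL u h, hr⟩
    · rcases ih2 (by omega) h with ⟨x, r, h, hr⟩ | ⟨x, r, h, hr⟩
      · exact .inl ⟨x, r, .plusR t h, hr⟩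
      · exact .inr ⟨x, r, .plusR t h, hr⟩
  | par t u ih1 ih2 => exact hpar t u ht ih1 ih2 h
  | op t u ih1 ih2 =>
    rcases hpar t u ht ih1 ih2 ((good_op_iff hI).1 h) with ⟨x, r, h, hr⟩ | ⟨x, r, h, hr⟩
    · exact .inl ⟨x, r, h.op_of_par, hr⟩
    · exact .inr ⟨x, r, h.op_of_par, hr⟩

/-- Sound equations between small terms preserve the invariant. -/
theorem Sound.good (hI : Interleaves R α) {n : ℕ} {t u : Tm} (hs : Sound R t u)
    (ht : t.size < n) {σ : ℕ → Tm} (hb : Below R α (t.subst σ) (epsLhs α n))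
    (h : Good R α n (t.subst σ)) : Good R α n (u.subst σ) := by
  rcases h.exposed hI ht with ⟨x, r, h, hr, hx⟩ | ⟨x, r, h, hr, hx⟩
  · have hm := hx.below hI _ ((moveTo_epsLhs hI).2 ⟨rfl, .inl (.refl _)⟩)
    obtain ⟨r', h', hr'⟩ := h.transfer hI hs hm
    exact h'.good_of_bisim_zero hx (hr'.2 hr)
  · obtain ⟨_, _, _, hm, _⟩ := id hx
    obtain ⟨r', h', hr'⟩ := h.transfer hI hs hm
    exact h'.good_of_twoDown hI hx (mt hr'.1 hr)
      fun w hw => hb w (hw.left (hs.bisim_subst σ).symm)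

/-! ### Invariance along derivations -/

theorem Sound.symm {t u : Tm} (h : Sound R t u) : Sound R u t := fun σ hσ => (h σ hσ).symm

theorem Bisim.below_iff {p q r : Tm} (h : Bisim R p q) : Below R α p r ↔ Below R α q r :=
  forall_congr' fun _ => by rw [h.moveTo_iff]

theorem Bisim.sameMoves_iff {p q r : Tm} (h : Bisim R p q) :
    SameMoves R α p r ↔ SameMoves R α q r :=
  forall_congr' fun _ => by rw [h.moveTo_iff]

/-- Quantifying over `σ` absorbs the substitution rule. `Below` takes the place of bisimilarity to
f(α, q_n) because, unlike the latter, it passes to both arguments of + and to a component whose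
partner is bisimilar to `0`, which the congruence rules need. -/
theorem Derives.good_iff (hI : Interleaves R α) {E : Set (Tm × Tm)} {n : ℕ}
    (hE : ∀ e ∈ E, Sound R e.1 e.2) (hn : ∀ e ∈ E, e.1.size < n ∧ e.2.size < n) {t u : Tm}
    (h : Derives E t u) (σ : ℕ → Tm) (hb : Below R α (t.subst σ) (epsLhs α n)) :
    Good R α n (t.subst σ) ↔ Good R α n (u.subst σ) := by
  have hpar : ∀ {p q p' q' : Tm}, Bisim R p q → Bisim R p' q' →
      (Below R α p (epsLhs α n) → (Good R α n p ↔ Good R α n q)) →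
      (Below R α p' (epsLhs α n) → (Good R α n p' ↔ Good R α n q')) →
      Below R α (.par p p') (epsLhs α n) →
      (Good R α n (.par p p') ↔ Good R α n (.par q q')) := by
    intro p q p' q' h h' ih ih' hb
    refine or_congr ?_ (or_congr ?_ ?_)
    · rw [h.zero_congr, h'.zero_congr, (h.par h').sameMoves_iff]
    · rw [← h'.zero_congr]
      exact and_congr_right fun h0 => ih (hb.left_of_par h0)
    · rw [← h.zero_congr]
      exact and_congr_right fun h0 => ih' (hb.right_of_par h0)
  induction h generalizing σ with
  | @ax t u h =>
    exact ⟨(hE _ h).good hI (hn _ h).1 hb,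
      (hE _ h).symm.good hI (hn _ h).2 (((hE _ h).bisim_subst σ).below_iff.1 hb)⟩
  | refl => rfl
  | symm h ih => exact (ih σ ((h.bisim_subst hE σ).below_iff.2 hb)).symm
  | trans h _ ih1 ih2 => exact (ih1 σ hb).trans (ih2 σ ((h.bisim_subst hE σ).below_iff.1 hb))
  | subst τ _ ih =>
    rw [subst_subst] at hb ⊢
    rw [subst_subst]
    exact ih _ hb
  | pre μ h _ => exact ((h.bisim_subst hE σ).pre μ).sameMoves_iff
  | plus _ _ ih1 ih2 =>
    exact or_congr (ih1 σ fun w hw => hb w (moveTo_plus.2 (.inl hw)))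
      (ih2 σ fun w hw => hb w (moveTo_plus.2 (.inr hw)))
  | par h1 h2 ih1 ih2 =>
    exact hpar (h1.bisim_subst hE σ) (h2.bisim_subst hE σ) (ih1 σ) (ih2 σ) hb
  | op h1 h2 ih1 ih2 =>
    exact (good_op_iff hI).trans ((hpar (h1.bisim_subst hE σ) (h2.bisim_subst hE σ) (ih1 σ)
      (ih2 σ) fun w hw => hb w (hI.moveTo_op_iff.2 hw)).trans (good_op_iff hI).symm)
  | plusComm t u => exact or_comm
  | plusAssoc t u v => exact or_assoc

/-! ### Summands -/

theorem Tm.IsSummand.moveTo {s t : Tm} (h : s.IsSummand t) {μ : Act} {w : Tm}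
    (hm : MoveTo R μ s w) : MoveTo R μ t w := by
  induction t with
  | plus t u ih1 ih2 => exact moveTo_plus.2 (h.imp ih1 ih2)
  | _ =>
    subst h
    exact hm

theorem Tm.IsSummand.good {n : ℕ} {s t : Tm} (h : s.IsSummand t) (hs : Good R α n s) :
    Good R α n t := by
  induction t with
  | plus t u ih1 ih2 => exact h.imp ih1 ih2
  | _ =>
    subst h
    exact hs

theorem not_isSummand_plus {p q t : Tm} : ¬ (Tm.plus p q).IsSummand t := by
  induction t with
  | plus t u ih1 ih2 => exact fun h => h.elim ih1 ih2
  | _ => nofun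

theorem Good.exists_isSummand {n : ℕ} {t : Tm} (h : Good R α n t) :
    ∃ s : Tm, s.IsSummand t ∧ Good R α n s := by
  induction t with
  | plus t u ih1 ih2 =>
    rcases h with h | h
    · exact (ih1 h).imp fun s hs => ⟨.inl hs.1, hs.2⟩
    · exact (ih2 h).imp fun s hs => ⟨.inr hs.1, hs.2⟩
  | _ => exact ⟨_, rfl, h⟩

theorem good_of_isSummand (hI : Interleaves R α) {n : ℕ} {s t : Tm} (hst : s.IsSummand t)
    (hb : Bisim R s (epsLhs α n)) (hz : ¬ HasZeroFactor R s) : Good R α n s := by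
  have hm : MoveTo R (.vis α) s (qn α n) :=
    ((moveTo_epsLhs hI).2 ⟨rfl, .inl (.refl _)⟩).left hb.symm
  cases s with
  | zero => exact (not_moveTo_zero hm).elim
  | var x => exact (not_moveTo_var hm).elim
  | pre μ p => exact hb.sameMoves
  | plus p q => exact (not_isSummand_plus hst).elim
  | par p q =>
    exact .inl ⟨fun h => hz ⟨p, q, .inl rfl, .inl h⟩, fun h => hz ⟨p, q, .inl rfl, .inr h⟩,
      hb.sameMoves⟩
  | op p q =>
    exact .inl ⟨fun h => hz ⟨p, q, .inr rfl, .inl h⟩, fun h => hz ⟨p, q, .inr rfl, .inr h⟩,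
      hb.sameMoves⟩

/-- Every transition of a summand is one of `t`, hence matched by f(α, q_n). Conversely f(α, q_n)
has `α`-transitions only, so the information in `Good` is enough to recover bisimilarity. -/
theorem Good.exists_summand_bisim (hI : Interleaves R α) {n : ℕ} {t : Tm} (h : Good R α n t)
    (hb : Bisim R t (epsLhs α n)) : ∃ s : Tm, s.IsSummand t ∧ Bisim R s (epsLhs α n) := by
  obtain ⟨s, hs, hg⟩ := h.exists_isSummand
  refine ⟨s, hs, bisim_of_moveTo fun μ w => ⟨fun hm => (hs.moveTo hm).left hb, fun hm => ?_⟩⟩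
  obtain rfl := ((moveTo_epsLhs hI).1 hm).1
  exact hg.below hI w hm

/-! ### Underivability of `ε_n` -/

theorem Good.exists_mem_sum {n : ℕ} {l : List Tm} (h : Good R α n (Tm.sum l)) :
    ∃ t ∈ l, Good R α n t := by
  induction l with
  | nil => exact h.elim
  | cons t l ih =>
    cases l with
    | nil => exact ⟨t, by simp, h⟩
    | cons u l =>
      rcases h with h | h
      · exact ⟨t, by simp, h⟩
      · obtain ⟨s, hs, hg⟩ := ih h
        exact ⟨s, List.mem_cons_of_mem _ hs, hg⟩

theorem good_epsLhs (n : ℕ) : Good R α n (epsLhs α n) :=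
  .inl ⟨not_one_bisim_zero, not_qn_bisim_zero, fun _ => .rfl⟩

theorem not_good_epsRhs (hI : Interleaves R α) {n : ℕ} (hn : 1 ≤ n) :
    ¬ Good R α n (epsRhs α n) := by
  rintro (h | h)
  · exact not_good_pre hI hn h
  · obtain ⟨t, ht, hg⟩ := h.exists_mem_sum
    obtain ⟨i, -, rfl⟩ := List.mem_map.1 ht
    exact not_good_pre hI hn hg

/-- The term is an application of `f`. -/
def IsOp (t : Tm) : Prop := ∃ p q, t = .op p q

/-- Without axioms, derivations preserve applications of `f`. -/
theorem Derives.isOp_iff {t u : Tm} (h : Derives ∅ t u) (σ : ℕ → Tm) :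
    IsOp (t.subst σ) ↔ IsOp (u.subst σ) := by
  induction h generalizing σ with
  | ax h => exact h.elim
  | refl => rfl
  | symm _ ih => exact (ih σ).symm
  | trans _ _ ih1 ih2 => exact (ih1 σ).trans (ih2 σ)
  | subst τ _ ih => simpa only [subst_subst] using ih _
  | _ => simp [IsOp, Tm.subst]

theorem not_derives_eps (hI : Interleaves R α) {E : Set (Tm × Tm)} {n : ℕ}
    (hE : ∀ e ∈ E, Sound R e.1 e.2) (hn : ∀ e ∈ E, e.1.size < n ∧ e.2.size < n) :
    ¬ Derives E (epsLhs α n) (epsRhs α n) := by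
  intro h
  -- The invariant separates the two sides only for n ≥ 1. For n = 0 the size bound leaves no
  -- axioms, and the head operators f and + tell the sides apart.
  rcases Nat.eq_zero_or_pos n with rfl | hpos
  · obtain rfl : E = ∅ := Set.eq_empty_of_forall_notMem fun e he => Nat.not_lt_zero _ (hn e he).1
    have := h.isOp_iff .var
    rw [subst_var, subst_var] at this
    obtain ⟨p, q, hpq⟩ := this.1 ⟨_, _, rfl⟩
    cases hpq
  · have := h.good_iff hI hE hn .var (by rw [subst_var]; exact fun _ => id)
    rw [subst_var, subst_var] at this
    exact not_good_epsRhs hI hpos (this.1 (good_epsLhs n))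

end CCSf

/-! ### The theorem -/

theorem mainTheorem6 (α : CCSf.Vis) (R : Set CCSf.Rule) (hR : CCSf.Admissible R)
    (hleft : CCSf.leftRule α ∈ R) (hright : CCSf.rightRule α ∈ R)
    (E : Set (CCSf.Tm × CCSf.Tm)) (hfin : E.Finite)
    (hsound : ∀ e ∈ E, CCSf.Sound R e.1 e.2)
    (n : ℕ) (hn : ∀ e ∈ E, e.1.size < n ∧ e.2.size < n) :
    (∀ p q : CCSf.Tm, p.Closed → q.Closed →
      CCSf.Bisim R p (CCSf.epsLhs α n) → CCSf.Bisim R q (CCSf.epsLhs α n) →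
      CCSf.Derives E p q →
      (∃ s : CCSf.Tm, s.IsSummand p ∧ CCSf.Bisim R s (CCSf.epsLhs α n) ∧
        ¬ CCSf.HasZeroFactor R s) →
      ∃ s : CCSf.Tm, s.IsSummand q ∧ CCSf.Bisim R s (CCSf.epsLhs α n)) ∧
    CCSf.Sound R (CCSf.epsLhs α n) (CCSf.epsRhs α n) ∧
    ¬ CCSf.Derives E (CCSf.epsLhs α n) (CCSf.epsRhs α n) := by
  have hI : CCSf.Interleaves R α := { hR with left_mem := hleft, right_mem := hright }
  refine ⟨?_, ?_, CCSf.not_derives_eps hI hsound hn⟩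
  · rintro p q - - hp hq hd ⟨s, hs, hb, hz⟩
    have hg := hd.good_iff hI hsound hn .var
    rw [CCSf.subst_var, CCSf.subst_var] at hg
    exact ((hg fun w hw => hw.left hp).1
      (hs.good (CCSf.good_of_isSummand hI hs hb hz))).exists_summand_bisim hI hq
  · intro σ _
    rw [CCSf.subst_of_closed σ (CCSf.closed_epsLhs α n),
      CCSf.subst_of_closed σ (CCSf.closed_epsRhs α n)]
    exact CCSf.epsLhs_bisim_epsRhs hI n
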